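/- Identify the plane with $\mathbb{R}^2$. Let $\Omega(\mathscr{T}_0)=[0,1]\times[0,1]\,\cup\,[-\tfrac12,\tfrac32]\times[1,\tfrac32]$, let $\phi_1(\mathbf x)=\tfrac12\mathbf x+(1,\tfrac32)$, $\phi_2(\mathbf x)=\tfrac12\mathbf x+(-\tfrac12,\tfrac32)$ and $\Phi(A)=\phi_1(A)\cup\phi_2(A)$. For $n\ge 0$ let $\Omega(\mathscr{T}_n)=\bigcup_{j=0}^n\Phi^j(\Omega(\mathscr{T}_0))$, and let $\Omega(\mathscr{T})=\overline{\bigcup_n\Omega(\mathscr{T}_n)}$ be the $T$-fractal billiard table. Its elusive points are the points of $\mathscr{E}=\Omega(\mathscr{T})\setminus\bigcup_n\Omega(\mathscr{T}_n)$. The base of $\Omega(\mathscr{T}_0)$ is $[0,1]\times\{0\}$, and the segments of the boundary of $\Omega(\mathscr{T}_n)$ that are removed in the construction of $\Omega(\mathscr{T}_{n+1})$ are the $2^{n+1}$ segments that make up $\Phi^{n+1}([0,1]\times\{0\})$. An initial condition of $\Omega(\mathscr{T}_n)$ is a pair $(x,\theta)$ of a boundary point and an inward pointing direction; its orbit $(x_n^k,\theta_n^k)_{k\ge0}$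 is obtained by iterating the billiard map of $\Omega(\mathscr{T}_n)$ (the orbit is reflected through both sides at a vertex of interior angle $\pi/2$, and terminates at a vertex of interior angle $3\pi/2$). It is periodic if it returns to its initial condition. Initial conditions $(x_n^0,\theta^0)$ of $\Omega(\mathscr{T}_n)$, $n\ge0$, are compatible if, for all $m<n$, the points $x_m^0$ and $x_n^0$ lie on a segment in direction $\theta^0$ that meets $\Omega(\mathscr{T}_n)$ only in $x_n^0$; the corresponding orbits form a sequence of compatible orbits. The first escape time $\tau_n$ is the least $k\ge1$ such that $x_n^k$ lies on a segment that is removed in the construction of $\Omega(\mathscr{T}_{n+1})$ (and $\infty$ if there is none); the escape path $\mathscr{N}_n$ is the polygonal path through $x_n^0,x_n^1,\dots,x_n^{\tau_n}$. A sequence of compatible orbits with $\tau_n<\infty$ for all $n\ge0$ yields the nontrivial path $\overline{\bigcup_{n\ge0}\mathscr{N}_n}$ of $\Omega(\mathscr{T})$. **Corollary.** Let $p\ge1$ be an odd integer, and let $x_0^0$ be a point on the base of $\Omega(\mathscr{T}_0)$ whose first coordinate is not of the form $m2^{-l}$ with positive integers $l,m$. Suppose that the initial conditions $(x_n^0,\theta^0)$,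 $n\ge0$, define a sequence of compatible periodic orbits, and that $\tan\theta^0=\frac1p$. Then $x_n^0=x_0^0$ for all $n\ge 0$, and for each of the two directions $\alpha\in\{\theta^0,\pi-\theta^0\}$: 1. the initial conditions $(x_n^0,\alpha)$, $n\ge0$, define a sequence of compatible orbits, each of which has a finite first escape time $\tau_n$; so they yield a nontrivial path $\mathscr{N}(x^0,\alpha)=\overline{\bigcup_{n\ge0}\mathscr{N}_n}$, where $x^0:=x_0^0$; 2. the escape paths $\mathscr{N}_n$ converge to $\mathscr{N}(x^0,\alpha)$ in the Hausdorff metric; 3. the nontrivial path reaches an elusive point: there is a point $e\in\mathscr{E}$ such that $\mathscr{N}(x^0,\alpha)\cap\mathscr{E}=\{e\}$ and the escape points $x_n^{\tau_n}$ converge to $e$ as $n\to\infty$. -/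

import Mathlib

open Filter Topology

namespace TFractal

/-! The Euclidean plane is `ℂ`: the point `(a, b)` is `a + b i`, the unit vector at angle `θ`
is `e^{iθ}`. -/

noncomputable section

/-! ### The table -/

/-- The polygon `Ω(𝒯₀)`: the unit square `[0,1] × [0,1]` together with the `2 × 1/2` rectangle
`[-1/2, 3/2] × [1, 3/2]` on top of it. -/
def baseTable : Set ℂ :=
  (Set.Icc (0 : ℝ) 1 ×ℂ Set.Icc (0 : ℝ) 1) ∪
    (Set.Icc (-1 / 2 : ℝ) (3 / 2) ×ℂ Set.Icc (1 : ℝ) (3 / 2))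

/-- The base of the table, the unit interval `[0,1] × {0}`. -/
def base : Set ℂ := segment ℝ (0 : ℂ) 1

/-- The contraction `φ₁(z) = z/2 + (1, 3/2)`. -/
def phi₁ (z : ℂ) : ℂ := z / 2 + ⟨1, 3 / 2⟩

/-- The contraction `φ₂(z) = z/2 + (-1/2, 3/2)`. -/
def phi₂ (z : ℂ) : ℂ := z / 2 + ⟨-1 / 2, 3 / 2⟩

/-- The set map `Φ(A) = φ₁(A) ∪ φ₂(A)`; `Φ^[j]` is the union over all words of length `j`. -/
def Phi (A : Set ℂ) : Set ℂ := phi₁ '' A ∪ phi₂ '' A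

/-- The prefractal table `Ω(𝒯ₙ) = ⋃_{j ≤ n} Φ^j(Ω(𝒯₀))`. -/
def table (n : ℕ) : Set ℂ := ⋃ j ≤ n, Phi^[j] baseTable

/-- The `T`-fractal table, the closure of the union of all `Ω(𝒯ₙ)`. -/
def fractalTable : Set ℂ := closure (⋃ n, table n)

/-- The elusive points. -/
def elusivePoints : Set ℂ := fractalTable \ ⋃ n, table n

/-- The union of the `2^(n+1)` boundary segments of `Ω(𝒯ₙ)` that are removed in the construction
of `Ω(𝒯ₙ₊₁)`: the bases of the copies of `Ω(𝒯₀)` of scale `2^(-n-1)` that are appended. -/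
def removedSegments (n : ℕ) : Set ℂ := Phi^[n + 1] base

/-! ### Billiards in a polygon with horizontal and vertical sides -/

/-- `x` is an interior point of a horizontal side of `Ω`: near `x`, the set `Ω` is a closed
half-plane with horizontal boundary line through `x`. -/
def OnHorizontalSide (Ω : Set ℂ) (x : ℂ) : Prop :=
  (∀ᶠ z in 𝓝 x, z ∈ Ω ↔ x.im ≤ z.im) ∨ (∀ᶠ z in 𝓝 x, z ∈ Ω ↔ z.im ≤ x.im)

/-- `x` is an interior point of a vertical side of `Ω`. -/
def OnVerticalSide (Ω : Set ℂ) (x : ℂ) : Prop :=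
  (∀ᶠ z in 𝓝 x, z ∈ Ω ↔ x.re ≤ z.re) ∨ (∀ᶠ z in 𝓝 x, z ∈ Ω ↔ z.re ≤ x.re)

/-- `x` is a vertex of `Ω` with a right interior angle: near `x`, the set `Ω` is one of the four
closed quadrants at `x`. -/
def IsRightAngle (Ω : Set ℂ) (x : ℂ) : Prop :=
  ∃ a b : ℝ, a ≠ 0 ∧ b ≠ 0 ∧
    ∀ᶠ z in 𝓝 x, z ∈ Ω ↔ 0 ≤ a * (z.re - x.re) ∧ 0 ≤ b * (z.im - x.im)

/-- The law of reflection at the boundary point `x`: the direction `v` is reflected to `v'`. At a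
right angle the trajectory is reflected through both sides; at any other vertex (those of
`Ω(𝒯ₙ)` have interior angle `3π/2`) there is no continuation. -/
def Reflects (Ω : Set ℂ) (x v v' : ℂ) : Prop :=
  (OnHorizontalSide Ω x ∧ v' = (starRingEnd ℂ) v) ∨
    (OnVerticalSide Ω x ∧ v' = -(starRingEnd ℂ) v) ∨
    (IsRightAngle Ω x ∧ v' = -v)

/-- One step of the billiard in `Ω`. From `(x, v)` the ball moves along `v` through the interior
until it meets the boundary at `x'`, where its direction becomes `v'`. -/
def BilliardStep (Ω : Set ℂ) (s s' : ℂ × ℂ) : Prop :=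
  ∃ t : ℝ, 0 < t ∧ s'.1 = s.1 + t • s.2 ∧
    (∀ u ∈ Set.Ioo 0 t, s.1 + u • s.2 ∈ interior Ω) ∧
    s'.1 ∈ frontier Ω ∧ Reflects Ω s'.1 s.2 s'.2

open Classical in
/-- The billiard map of `Ω(𝒯ₙ)`, a partial map on pairs (base point, direction); `none` means that
the trajectory terminates. -/
def billiardMap (n : ℕ) (s : ℂ × ℂ) : Option (ℂ × ℂ) :=
  if h : ∃ s', BilliardStep (table n) s s' then some h.choose else none

/-- The unit vector at angle `θ`. -/
def direction (θ : ℝ) : ℂ := Complex.exp (θ * Complex.I)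

/-- The orbit of `Ω(𝒯ₙ)` with initial condition `(x, θ)`: `orbit n x θ k` is the pair
`f_n^k(x, θ)` of the `k`-th base point and the `k`-th direction. -/
def orbit (n : ℕ) (x : ℂ) (θ : ℝ) : ℕ → Option (ℂ × ℂ)
  | 0 => some (x, direction θ)
  | k + 1 => (orbit n x θ k).bind (billiardMap n)

/-- The orbit returns to its initial condition. -/
def IsPeriodicOrbit (n : ℕ) (x : ℂ) (θ : ℝ) : Prop :=
  ∃ k : ℕ, 0 < k ∧ orbit n x θ k = some (x, direction θ)

/-! ### Compatible sequences -/

/-- `(x, θ)` is an initial condition of an orbit of `Ω(𝒯ₙ)`: the point `x` is on the boundary and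
`θ` points into the interior. -/
def IsInitialCondition (n : ℕ) (x : ℂ) (θ : ℝ) : Prop :=
  x ∈ frontier (table n) ∧
    ∀ᶠ t : ℝ in 𝓝[>] 0, x + t • direction θ ∈ interior (table n)

/-- For `m < n`, the initial conditions `(xₙ, θ)` of `Ω(𝒯ₙ)` and `(xₘ, θ)` of `Ω(𝒯ₘ)` are
compatible: the points lie on a segment in direction `θ` that meets `Ω(𝒯ₙ)` only in `xₙ`. -/
def AreCompatible (n : ℕ) (xₙ xₘ : ℂ) (θ : ℝ) : Prop :=
  (∃ t : ℝ, xₙ = xₘ + t • direction θ) ∧ segment ℝ xₘ xₙ ∩ table n = {xₙ}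

/-- `{(xₙ, θ)}_{n ≥ 0}` is a sequence of compatible initial conditions; the corresponding orbits
of `Ω(𝒯ₙ)` then form a sequence of compatible orbits. -/
def IsCompatibleSequence (x : ℕ → ℂ) (θ : ℝ) : Prop :=
  (∀ n, IsInitialCondition n (x n) θ) ∧ ∀ m n, m < n → AreCompatible n (x n) (x m) θ

/-- A sequence of compatible periodic orbits. -/
def IsCompatiblePeriodicSequence (x : ℕ → ℂ) (θ : ℝ) : Prop :=
  IsCompatibleSequence x θ ∧ ∀ n, IsPeriodicOrbit n (x n) θ

/-! ### Escape times and nontrivial paths -/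

/-- The first escape time `τₙ`: the least positive `k` such that the `k`-th base point lies on a
segment to be removed, and `⊤` if there is none. -/
def escapeTime (n : ℕ) (x : ℂ) (θ : ℝ) : ℕ∞ :=
  ⨅ k ∈ {k : ℕ | 0 < k ∧ ∃ s, orbit n x θ k = some s ∧ s.1 ∈ removedSegments n}, (k : ℕ∞)

/-- `y` is the base point of the orbit at the (finite) first escape time. -/
def IsEscapePoint (n : ℕ) (x : ℂ) (θ : ℝ) (y : ℂ) : Prop :=
  ∃ (k : ℕ) (v : ℂ), escapeTime n x θ = k ∧ orbit n x θ k = some (y, v)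

/-- The path connecting the base points number `0, …, τₙ` of the orbit. -/
def escapePath (n : ℕ) (x : ℂ) (θ : ℝ) : Set ℂ :=
  {z | ∃ (k : ℕ) (s s' : ℂ × ℂ), (k : ℕ∞) < escapeTime n x θ ∧
    orbit n x θ k = some s ∧ orbit n x θ (k + 1) = some s' ∧ z ∈ segment ℝ s.1 s'.1}

/-- The sequence yields a nontrivial path: it is a sequence of compatible orbits, each of which has
a finite first escape time. -/
def YieldsNontrivialPath (x : ℕ → ℂ) (θ : ℝ) : Prop :=
  IsCompatibleSequence x θ ∧ ∀ n, escapeTime n (x n) θ < ⊤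

/-- The nontrivial path, the closure of the union of the escape paths. -/
def nontrivialPath (x : ℕ → ℂ) (θ : ℝ) : Set ℂ :=
  closure (⋃ n, escapePath n (x n) θ)

end

/-! ### The billiard map is well defined -/

theorem eventually_line {x : ℂ} {P : ℂ → Prop} (h : ∀ᶠ z in 𝓝 x, P z) (w : ℂ) :
    ∃ t : ℝ, 0 < t ∧ P (x + t • w) ∧ P (x + t • (-w)) := by
  have key : ∀ w : ℂ, ∀ᶠ t : ℝ in 𝓝[>] 0, P (x + t • w) := by
    intro w
    have hc : ContinuousAt (fun t : ℝ => x + t • w) 0 := by fun_prop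
    have : Tendsto (fun t : ℝ => x + t • w) (𝓝[>] 0) (𝓝 x) := by
      have h0 := hc.tendsto
      simp only [zero_smul, add_zero] at h0
      exact h0.mono_left nhdsWithin_le_nhds
    exact this.eventually h
  obtain ⟨t, ⟨h1, h2⟩, h3⟩ :=
    (((key w).and (key (-w))).and self_mem_nhdsWithin).exists
  exact ⟨t, h3, h1, h2⟩

theorem not_horizontal_vertical {Ω : Set ℂ} {x : ℂ} (h : OnHorizontalSide Ω x)
    (h' : OnVerticalSide Ω x) : False := by
  rcases h with h | h <;> rcases h' with h' | h' <;>
  · obtain ⟨t, ht, ⟨h1, h2⟩, h3, h4⟩ := eventually_line (h.and h') Complex.I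
    simp at h1 h2 h3 h4
    simp_all
    try linarith

theorem not_horizontal_right {Ω : Set ℂ} {x : ℂ} (h : OnHorizontalSide Ω x)
    (h' : IsRightAngle Ω x) : False := by
  obtain ⟨a, b, ha, hb, h'⟩ := h'
  rcases h with h | h <;>
  · obtain ⟨t, ht, ⟨h1, h2⟩, h3, h4⟩ := eventually_line (h.and h') 1
    simp at h1 h2 h3 h4
    have e1 := h2.1 h1
    have e2 := h4.1 h3
    have : a * t = 0 := by linarith
    simp [ha, ht.ne'] at this

theorem not_vertical_right {Ω : Set ℂ} {x : ℂ} (h : OnVerticalSide Ω x)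
    (h' : IsRightAngle Ω x) : False := by
  obtain ⟨a, b, ha, hb, h'⟩ := h'
  rcases h with h | h <;>
  · obtain ⟨t, ht, ⟨h1, h2⟩, h3, h4⟩ := eventually_line (h.and h') Complex.I
    simp at h1 h2 h3 h4
    have e1 := h2.1 h1
    have e2 := h4.1 h3
    have : b * t = 0 := by linarith
    simp [hb, ht.ne'] at this

theorem BilliardStep.unique {Ω : Set ℂ} {s s₁ s₂ : ℂ × ℂ} (h₁ : BilliardStep Ω s s₁)
    (h₂ : BilliardStep Ω s s₂) : s₁ = s₂ := by
  obtain ⟨t, ht, e, hi, hf, hr⟩ := h₁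
  obtain ⟨t', ht', e', hi', hf', hr'⟩ := h₂
  have htt : t = t' := by
    rcases lt_trichotomy t t' with h | h | h
    · exact absurd (hi' t ⟨ht, h⟩) (e ▸ hf.2)
    · exact h
    · exact absurd (hi t' ⟨ht', h⟩) (e' ▸ hf'.2)
  have h1 : s₁.1 = s₂.1 := by rw [e, e', htt]
  refine Prod.ext h1 ?_
  rw [← h1] at hr'
  rcases hr with ⟨a, b⟩ | ⟨a, b⟩ | ⟨a, b⟩ <;> rcases hr' with ⟨a', b'⟩ | ⟨a', b'⟩ | ⟨a', b'⟩
  · rw [b, b']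
  · exact (not_horizontal_vertical a a').elim
  · exact (not_horizontal_right a a').elim
  · exact (not_horizontal_vertical a' a).elim
  · rw [b, b']
  · exact (not_vertical_right a a').elim
  · exact (not_horizontal_right a' a).elim
  · exact (not_vertical_right a' a).elim
  · rw [b, b']

theorem billiardMap_eq_some_iff {n : ℕ} {s s' : ℂ × ℂ} :
    billiardMap n s = some s' ↔ BilliardStep (table n) s s' := by
  unfold billiardMap
  constructor
  · intro h
    split_ifs at h with h0
    rw [← Option.some.inj h]
    exact h0.choose_spec
  · intro h
    have h0 : ∃ s', BilliardStep (table n) s s' := ⟨s', h⟩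
    rw [dif_pos h0, h0.choose_spec.unique h]

end TFractal

open TFractal

namespace TFractal

/-! ### Trajectories -/

/-! Record a position as the signed distance `s` from the axis `re = 1/2`, measured in the current
horizontal direction. A wall hit then only subtracts the width of the channel from `s`, so billiards
in a rectangle is translation modulo the width. At slope `1/p` the stem (width 1, height 1) shifts
`s` by `p`, so `s` comes back unchanged. Each crossing of the bar (width 2, height 1/2) shifts `s`
by `p/2` modulo 2.

A ball entering through the base at `s`, `|s| < 1/2`, reaches the top at `s₁ ≡ s + p/2`. If `|s₁| >
1/2`, it is on the base of a child. Otherwise it bounces down to `s₂ ≡ s + p`. As `p` is odd, `s₂ -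
s` is an odd integer, so `|s₂| > 1/2`: the ball misses the stem and bounces up to `s₃`. By the same
parity `|s₃ - s₁|` is odd, so `|s₃| > 1/2` and the ball leaves through a child. Positions stay
non-dyadic, hence no vertex is met (`exists_passage`).

The child is entered with the same slope, at another non-dyadic position, so the passage repeats at
half the scale (`Passage.trajectory_pathUpTo`). The passage through a layer does not depend on `n`,
so the escape paths are nested, and what follows layer `n` lies in a copy of size `2⁻ⁿ`. This gives
the Hausdorff limit. The exit points form a Cauchy sequence with heights tending to 3, which no
`Ω(𝒯ₙ)` reaches.

Compatibility makes `x n` constant because `x 0` lies in every table. Periodicity excludes the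
corner `0`, from which the ball runs into the vertex `(1, 1)`. The direction `π - θ` is the same
argument with the other horizontal sign. -/

/-- The ball moves from `s` to `s'` along a straight line through the interior of `Ω`. -/
def Approach (Ω : Set ℂ) (s s' : ℂ × ℂ) : Prop :=
  s'.2 = s.2 ∧ ∃ t : ℝ, 0 < t ∧ s'.1 = s.1 + t • s.2 ∧
    ∀ u ∈ Set.Ioo 0 t, s.1 + u • s.2 ∈ interior Ω

/-- `Trajectory Ω R s s' P`: the ball moves from `s` to `s'` along the polygonal path `P`, and its
collisions before the arrival at `s'.1` are not in `R`. -/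
inductive Trajectory (Ω R : Set ℂ) : ℂ × ℂ → ℂ × ℂ → Set ℂ → Prop
  | approach {s s' : ℂ × ℂ} (h : Approach Ω s s') : Trajectory Ω R s s' (segment ℝ s.1 s'.1)
  | step {s s₁ s' : ℂ × ℂ} {P : Set ℂ} (h : BilliardStep Ω s s₁) (hR : s₁.1 ∉ R)
      (h' : Trajectory Ω R s₁ s' P) : Trajectory Ω R s s' (segment ℝ s.1 s₁.1 ∪ P)

theorem Approach.billiardStep {Ω : Set ℂ} {s s' : ℂ × ℂ} {v : ℂ} (h : Approach Ω s s')
    (hf : s'.1 ∈ frontier Ω) (hr : Reflects Ω s'.1 s'.2 v) : BilliardStep Ω s (s'.1, v) := by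
  obtain ⟨hv, t, ht, he, hi⟩ := h
  exact ⟨t, ht, he, hi, hf, hv ▸ hr⟩

theorem BilliardStep.approach {Ω : Set ℂ} {s s' : ℂ × ℂ} (h : BilliardStep Ω s s') :
    Approach Ω s (s'.1, s.2) := by
  obtain ⟨t, ht, he, hi, -⟩ := h
  exact ⟨rfl, t, ht, he, hi⟩

theorem Approach.trans {Ω : Set ℂ} {s s₁ s' : ℂ × ℂ} (h : Approach Ω s s₁)
    (hi : s₁.1 ∈ interior Ω) (h' : Approach Ω s₁ s') : Approach Ω s s' := by
  obtain ⟨hv, t, ht, he, hint⟩ := h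
  obtain ⟨hv', t', ht', he', hint'⟩ := h'
  refine ⟨hv'.trans hv, t + t', by positivity, ?_, ?_⟩
  · rw [he', he, hv, add_smul, add_assoc]
  · rintro u ⟨hu, hu'⟩
    rcases lt_trichotomy u t with hlt | rfl | hgt
    · exact hint u ⟨hu, hlt⟩
    · rwa [← he]
    · have := hint' (u - t) ⟨by linarith, by linarith⟩
      rwa [he, hv, add_assoc, ← add_smul, add_sub_cancel] at this

theorem Approach.segment_union {Ω : Set ℂ} {s s₁ s' : ℂ × ℂ} (h : Approach Ω s s₁)
    (h' : Approach Ω s₁ s') :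
    segment ℝ s.1 s₁.1 ∪ segment ℝ s₁.1 s'.1 = segment ℝ s.1 s'.1 := by
  obtain ⟨hv, t, ht, he, -⟩ := h
  obtain ⟨-, t', ht', he', -⟩ := h'
  have hmem : s₁.1 ∈ segment ℝ s.1 s'.1 := by
    rw [segment_eq_image']
    refine ⟨t / (t + t'), ⟨by positivity, by rw [div_le_one (by positivity)]; linarith⟩, ?_⟩
    have h0 : s'.1 - s.1 = (t + t') • s.2 := by rw [he', he, hv, add_smul]; abel
    simp only [h0, smul_smul, he]
    rw [div_mul_cancel₀ _ (by positivity)]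
  refine subset_antisymm (Set.union_subset
    ((convex_segment _ _).segment_subset (left_mem_segment ℝ _ _) hmem)
    ((convex_segment _ _).segment_subset hmem (right_mem_segment ℝ _ _))) ?_
  have h1 := insert_endpoints_openSegment ℝ s.1 s'.1
  rw [← h1]
  rintro z (rfl | rfl | hz)
  · exact Or.inl (left_mem_segment ℝ _ _)
  · exact Or.inr (right_mem_segment ℝ _ _)
  · rcases openSegment_subset_union s.1 s'.1 (z := s₁.1) (by
      rw [segment_eq_image_lineMap] at hmem
      obtain ⟨r, -, hr⟩ := hmem
      exact ⟨r, hr⟩) hz with rfl | hz | hz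
    · exact Or.inl (right_mem_segment ℝ _ _)
    · exact Or.inl (openSegment_subset_segment ℝ _ _ hz)
    · exact Or.inr (openSegment_subset_segment ℝ _ _ hz)

namespace Trajectory

variable {Ω R : Set ℂ} {s s₁ s' : ℂ × ℂ} {P Q : Set ℂ}

/-- A trajectory ends in an arrival, not in a collision. The same arrival can thus be continued by a
reflection, or by `cross` where the segment has been removed and the point is interior. -/
theorem bounce {v : ℂ} (h : Trajectory Ω R s s₁ P) (hf : s₁.1 ∈ frontier Ω) (hR : s₁.1 ∉ R)
    (hr : Reflects Ω s₁.1 s₁.2 v) (h' : Trajectory Ω R (s₁.1, v) s' Q) :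
    Trajectory Ω R s s' (P ∪ Q) := by
  induction h with
  | approach h => exact step (s₁ := (_, v)) (h.billiardStep hf hr) hR h'
  | step h hR' _ ih => rw [Set.union_assoc]; exact step h hR' (ih hf hR hr h')

theorem cross (h : Trajectory Ω R s s₁ P) (hi : s₁.1 ∈ interior Ω)
    (h' : Trajectory Ω R s₁ s' Q) : Trajectory Ω R s s' (P ∪ Q) := by
  induction h with
  | approach h =>
    cases h' with
    | approach h' => rw [h.segment_union h']; exact approach (h.trans hi h')
    | step h' hR' h'' =>
      rw [← Set.union_assoc]
      have := h.segment_union h'.approach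
      dsimp only at this
      rw [this]
      have hs := h.trans hi h'.approach
      obtain ⟨t, ht, he, hint, hf, hr⟩ := h'
      refine step ?_ hR' h''
      have := hs.billiardStep hf (h.1 ▸ hs.1 ▸ hr)
      exact this
  | step h hR' _ ih => rw [Set.union_assoc]; exact step h hR' (ih hi h')

theorem right_mem (h : Trajectory Ω R s s' P) : s'.1 ∈ P := by
  induction h with
  | approach => exact right_mem_segment ℝ _ _
  | step _ _ _ ih => exact Or.inr ih

theorem isClosed (h : Trajectory Ω R s s' P) : IsClosed P := by
  have hs : ∀ x y : ℂ, IsClosed (segment ℝ x y) := fun x y => by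
    rw [segment_eq_image_lineMap]
    exact (isCompact_Icc.image (by fun_prop)).isClosed
  induction h with
  | approach => exact hs _ _
  | step _ _ _ ih => exact (hs _ _).union ih

end Trajectory

theorem Approach.segment_subset {Ω : Set ℂ} {s s' : ℂ × ℂ} (hΩ : IsClosed Ω)
    (h : Approach Ω s s') : segment ℝ s.1 s'.1 ⊆ Ω := by
  obtain ⟨-, t, ht, he, hi⟩ := h
  -- Only the open segment is known to be interior; closedness of `Ω` adds the endpoints.
  have ho : openSegment ℝ s.1 s'.1 ⊆ Ω := by
    rw [openSegment_eq_image']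
    rintro _ ⟨r, ⟨hr, hr'⟩, rfl⟩
    have := interior_subset (hi (r * t) ⟨by positivity, by nlinarith⟩)
    simpa [he, mul_assoc] using this
  calc segment ℝ s.1 s'.1 ⊆ closure (openSegment ℝ s.1 s'.1) :=
        segment_subset_closure_openSegment
    _ ⊆ Ω := closure_minimal ho hΩ

theorem Trajectory.subset {Ω R : Set ℂ} {s s' : ℂ × ℂ} {P : Set ℂ} (hΩ : IsClosed Ω)
    (h : Trajectory Ω R s s' P) : P ⊆ Ω := by
  induction h with
  | approach h => exact h.segment_subset hΩ
  | step h _ _ ih =>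
    have hseg := h.approach.segment_subset hΩ
    exact Set.union_subset hseg ih

/-- The billiard steps of a trajectory. -/
theorem Trajectory.exists_steps {Ω R : Set ℂ} {s s' : ℂ × ℂ} {P : Set ℂ}
    (h : Trajectory Ω R s s' P) : ∃ (k : ℕ) (σ : ℕ → ℂ × ℂ), σ 0 = s ∧
      (∀ i < k, BilliardStep Ω (σ i) (σ (i + 1)) ∧ (σ (i + 1)).1 ∉ R) ∧ Approach Ω (σ k) s' ∧
      P = (⋃ i < k, segment ℝ (σ i).1 (σ (i + 1)).1) ∪ segment ℝ (σ k).1 s'.1 := by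
  induction h with
  | @approach s s' h => exact ⟨0, fun _ => s, rfl, by simp, h, by simp⟩
  | @step s s₁ s' P h hR _ ih =>
    obtain ⟨k, σ, h0, hs, ha, hP⟩ := ih
    refine ⟨k + 1, fun i => Nat.casesOn i s σ, rfl, ?_, ha, ?_⟩
    · rintro (_ | i) hi
      · simp only [h0]; exact ⟨h, hR⟩
      · exact hs i (by omega)
    · rw [hP, ← Set.union_assoc]
      congr 1
      ext z
      simp only [Set.mem_union, Set.mem_iUnion]
      constructor
      · rintro (hz | ⟨i, hi, hz⟩)
        · exact ⟨0, by omega, by simpa [h0] using hz⟩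
        · exact ⟨i + 1, by omega, hz⟩
      · rintro ⟨_ | i, hi, hz⟩
        · left; simpa [h0] using hz
        · exact Or.inr ⟨i, by omega, hz⟩

theorem orbit_eq_of_steps {n : ℕ} {x : ℂ} {θ : ℝ} {k : ℕ} {σ : ℕ → ℂ × ℂ}
    (h0 : σ 0 = (x, direction θ))
    (hs : ∀ i < k, BilliardStep (table n) (σ i) (σ (i + 1))) :
    ∀ i ≤ k, orbit n x θ i = some (σ i) := by
  intro i
  induction i with
  | zero => intro _; rw [h0]; rfl
  | succ i ih =>
    intro hi
    rw [orbit, ih (by omega)]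
    exact billiardMap_eq_some_iff.2 (hs i (by omega))

/-- A trajectory that arrives at a removed segment gives the escape time, point and path. -/
theorem Trajectory.escape {n : ℕ} {x y v : ℂ} {θ : ℝ} {R P : Set ℂ} (hR : removedSegments n ⊆ R)
    (h : Trajectory (table n) R (x, direction θ) (y, v) P) (hy : y ∈ removedSegments n)
    (hf : y ∈ frontier (table n)) (hh : OnHorizontalSide (table n) y) :
    escapeTime n x θ < ⊤ ∧ IsEscapePoint n x θ y ∧ escapePath n x θ = P := by
  obtain ⟨k, σ, h0, hs, ha, hP⟩ := h.exists_steps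
  set v' := (starRingEnd ℂ) v
  have hlast : BilliardStep (table n) (σ k) (y, v') :=
    ha.billiardStep hf (Or.inl ⟨hh, rfl⟩)
  have horb := orbit_eq_of_steps h0 (fun i hi => (hs i hi).1)
  have hend : orbit n x θ (k + 1) = some (y, v') := by
    rw [orbit, horb k le_rfl]
    exact billiardMap_eq_some_iff.2 hlast
  have htime : escapeTime n x θ = (k + 1 : ℕ) := by
    -- Minimality: all earlier base points avoid `R`, hence the removed segments.
    refine le_antisymm (iInf₂_le (k + 1) ⟨by omega, _, hend, hy⟩) (le_iInf₂ ?_)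
    rintro j ⟨hj, s, hjs, hsR⟩
    by_contra hlt
    rw [not_le, Nat.cast_lt] at hlt
    obtain ⟨i, rfl⟩ : ∃ i, j = i + 1 := ⟨j - 1, by omega⟩
    rw [horb (i + 1) (by omega)] at hjs
    rw [← Option.some.inj hjs] at hsR
    exact (hs i (by omega)).2 (hR hsR)
  refine ⟨by rw [htime]; exact ENat.natCast_lt_top _, ⟨k + 1, v', htime, hend⟩, ?_⟩
  rw [hP]
  ext z
  simp only [escapePath, htime, Set.mem_ofPred_eq, Nat.cast_lt, Set.mem_union, Set.mem_iUnion]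
  constructor
  · rintro ⟨i, s, s', hi, hs1, hs2, hz⟩
    rw [horb i (by omega)] at hs1
    rw [← Option.some.inj hs1] at hz
    rcases (Nat.lt_succ_iff.1 hi).lt_or_eq with hlt | rfl
    · rw [horb (i + 1) (by omega)] at hs2
      rw [← Option.some.inj hs2] at hz
      exact Or.inl ⟨i, hlt, hz⟩
    · rw [hend] at hs2
      rw [← Option.some.inj hs2] at hz
      exact Or.inr hz
  · rintro (⟨i, hi, hz⟩ | hz)
    · exact ⟨i, _, _, by omega, horb i (by omega), horb (i + 1) (by omega), hz⟩
    · exact ⟨k, _, _, by omega, horb k le_rfl, hend, hz⟩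

/-- An orbit that arrives at a point without continuation is not periodic. -/
theorem Trajectory.not_isPeriodicOrbit {n : ℕ} {x y v : ℂ} {θ : ℝ} {R P : Set ℂ} (hx : x ∈ R)
    (h : Trajectory (table n) R (x, direction θ) (y, v) P) (hf : y ∈ frontier (table n))
    (hr : ∀ w, ¬ Reflects (table n) y v w) : ¬ IsPeriodicOrbit n x θ := by
  obtain ⟨k, σ, h0, hs, ⟨hv, t, ht, he, hi⟩, -⟩ := h.exists_steps
  have horb := orbit_eq_of_steps h0 (fun i hi => (hs i hi).1)
  have hnone : billiardMap n (σ k) = none := by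
    rw [Option.eq_none_iff_forall_ne_some]
    intro s hs
    obtain ⟨t', ht', he', hi', hf', hr'⟩ := billiardMap_eq_some_iff.1 hs
    dsimp only at he hv
    -- Any billiard step from here must stop exactly at the frontier point `y`, where no reflection
    -- exists.
    rcases lt_trichotomy t t' with hlt | rfl | hlt
    · exact hf.2 (he ▸ hi' t ⟨ht, hlt⟩)
    · rw [he', ← he, ← hv] at hr'
      exact hr _ hr'
    · exact hf'.2 (he' ▸ hi t' ⟨ht', hlt⟩)
  have hend : ∀ j, orbit n x θ (k + 1 + j) = none := by
    intro j
    induction j with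
    | zero => rw [add_zero, orbit, horb k le_rfl]; exact hnone
    | succ j ih => rw [← add_assoc, orbit, ih]; rfl
  rintro ⟨j, hj, hper⟩
  -- A return after step `k` is impossible because the orbit has ended; an earlier one would be a
  -- collision in `R`, which contains `x`.
  rcases Nat.lt_or_ge k j with hlt | hle
  · obtain ⟨i, rfl⟩ := Nat.exists_eq_add_of_le hlt
    have := hend i
    rw [Nat.succ_eq_add_one] at hper
    rw [hper] at this
    cases this
  · obtain ⟨i, rfl⟩ : ∃ i, j = i + 1 := ⟨j - 1, by omega⟩
    rw [horb (i + 1) hle] at hper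
    have := (hs i (by omega)).2
    rw [Option.some.inj hper] at this
    exact this hx


/-! ### The geometry of the tables -/

/-- The two contractions in one formula: `φ₁` for `η = 1` and `φ₂` for `η = -1`. -/
noncomputable def contraction (η : ℝ) (z : ℂ) : ℂ := z / 2 + ⟨1 / 4 + η * (3 / 4), 3 / 2⟩

/-- The inverse of `contraction η`. -/
noncomputable def expansion (η : ℝ) (z : ℂ) : ℂ := 2 * (z - ⟨1 / 4 + η * (3 / 4), 3 / 2⟩)

theorem contraction_one : contraction 1 = phi₁ := by
  funext z; simp only [contraction, phi₁]; norm_num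

theorem contraction_neg_one : contraction (-1) = phi₂ := by
  funext z; simp only [contraction, phi₂]; norm_num

@[simp] theorem contraction_re (η : ℝ) (z : ℂ) :
    (contraction η z).re = z.re / 2 + (1 / 4 + η * (3 / 4)) := by simp [contraction]

@[simp] theorem contraction_im (η : ℝ) (z : ℂ) :
    (contraction η z).im = z.im / 2 + 3 / 2 := by simp [contraction]

@[simp] theorem expansion_re (η : ℝ) (z : ℂ) :
    (expansion η z).re = 2 * (z.re - (1 / 4 + η * (3 / 4))) := by simp [expansion]

@[simp] theorem expansion_im (η : ℝ) (z : ℂ) :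
    (expansion η z).im = 2 * (z.im - 3 / 2) := by simp [expansion]

@[simp] theorem expansion_contraction (η : ℝ) (z : ℂ) : expansion η (contraction η z) = z := by
  simp only [expansion, contraction]; ring

@[simp] theorem contraction_expansion (η : ℝ) (z : ℂ) : contraction η (expansion η z) = z := by
  simp only [expansion, contraction]; ring

theorem continuous_expansion (η : ℝ) : Continuous (expansion η) := by
  unfold expansion; fun_prop

theorem continuous_contraction (η : ℝ) : Continuous (contraction η) := by
  unfold contraction; fun_prop

theorem dist_contraction (η : ℝ) (z w : ℂ) :
    dist (contraction η z) (contraction η w) = dist z w / 2 := by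
  rw [contraction, contraction, dist_add_right, dist_eq_norm, dist_eq_norm, ← sub_div, norm_div]
  norm_num

/-- Pulling back along the affine inverse turns membership in a copy into linear inequalities in the
coordinates. -/
theorem mem_Phi {A : Set ℂ} {z : ℂ} :
    z ∈ Phi A ↔ ∃ η : ℝ, (η = 1 ∨ η = -1) ∧ expansion η z ∈ A := by
  have key : ∀ η, z ∈ contraction η '' A ↔ expansion η z ∈ A := fun η =>
    ⟨by rintro ⟨w, hw, rfl⟩; simpa using hw, fun h => ⟨_, h, by simp⟩⟩
  rw [Phi, ← contraction_one, ← contraction_neg_one, Set.mem_union, key, key]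
  constructor
  · rintro (h | h)
    · exact ⟨1, Or.inl rfl, h⟩
    · exact ⟨-1, Or.inr rfl, h⟩
  · rintro ⟨η, rfl | rfl, h⟩
    · exact Or.inl h
    · exact Or.inr h

theorem table_zero : table 0 = baseTable := by
  simp [table]

/-- The outermost contraction is peeled off, which is the self-similarity behind the inductions on
`n`. -/
theorem table_succ (n : ℕ) : table (n + 1) = baseTable ∪ Phi (table n) := by
  ext z
  simp only [table, Set.mem_union, mem_Phi, Set.mem_iUnion]
  constructor
  · rintro ⟨_ | j, hj, hz⟩
    · exact Or.inl hz
    · rw [Function.iterate_succ_apply', mem_Phi] at hz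
      obtain ⟨η, hη, hz⟩ := hz
      exact Or.inr ⟨η, hη, j, by omega, hz⟩
  · rintro (hz | ⟨η, hη, j, hj, hz⟩)
    · exact ⟨0, by omega, hz⟩
    · refine ⟨j + 1, by omega, ?_⟩
      rw [Function.iterate_succ_apply', mem_Phi]
      exact ⟨η, hη, hz⟩

theorem mem_baseTable {z : ℂ} : z ∈ baseTable ↔
    ((0 ≤ z.re ∧ z.re ≤ 1) ∧ 0 ≤ z.im ∧ z.im ≤ 1) ∨
      ((-1 / 2 ≤ z.re ∧ z.re ≤ 3 / 2) ∧ 1 ≤ z.im ∧ z.im ≤ 3 / 2) := Iff.rfl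

theorem isClosed_baseTable : IsClosed baseTable :=
  (isClosed_Icc.reProdIm isClosed_Icc).union (isClosed_Icc.reProdIm isClosed_Icc)

theorem isClosed_table (n : ℕ) : IsClosed (table n) := by
  induction n with
  | zero => rw [table_zero]; exact isClosed_baseTable
  | succ n ih =>
    have : Phi (table n) = expansion 1 ⁻¹' table n ∪ expansion (-1) ⁻¹' table n := by
      ext z
      rw [mem_Phi]
      constructor
      · rintro ⟨η, rfl | rfl, h⟩
        exacts [Or.inl h, Or.inr h]
      · rintro (h | h)
        exacts [⟨1, Or.inl rfl, h⟩, ⟨-1, Or.inr rfl, h⟩]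
    rw [table_succ, this]
    exact isClosed_baseTable.union ((ih.preimage (continuous_expansion _)).union
      (ih.preimage (continuous_expansion _)))

theorem baseTable_subset_table (n : ℕ) : baseTable ⊆ table n :=
  fun _ hz => Set.mem_iUnion₂.2 ⟨0, Nat.zero_le n, hz⟩

/-- The table lies in the box `[-1, 2] × [0, 3)`, and its part below height `1` is in the stem. -/
theorem bounds_of_mem_table {n : ℕ} {z : ℂ} (hz : z ∈ table n) :
    0 ≤ z.im ∧ z.im < 3 ∧ -1 < z.re ∧ z.re < 2 ∧ (z.im < 1 → 0 ≤ z.re ∧ z.re ≤ 1) := by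
  have hb : ∀ z ∈ baseTable,
      0 ≤ z.im ∧ z.im < 3 ∧ -1 < z.re ∧ z.re < 2 ∧ (z.im < 1 → 0 ≤ z.re ∧ z.re ≤ 1) := by
    intro z hz
    rw [mem_baseTable] at hz
    rcases hz with ⟨⟨h1, h2⟩, h3, h4⟩ | ⟨⟨h1, h2⟩, h3, h4⟩
    · exact ⟨h3, by linarith, by linarith, by linarith, fun _ => ⟨h1, h2⟩⟩
    · exact ⟨by linarith, by linarith, by linarith, by linarith, fun h => by linarith⟩
  induction n generalizing z with
  | zero => rw [table_zero] at hz; exact hb z hz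
  | succ n ih =>
    rw [table_succ] at hz
    rcases hz with hz | hz
    · exact hb z hz
    · rw [mem_Phi] at hz
      obtain ⟨η, hη, hz⟩ := hz
      obtain ⟨h1, h2, h3, h4, -⟩ := ih hz
      rw [expansion_im] at h1 h2
      rw [expansion_re] at h3 h4
      -- The strict bounds reproduce themselves: height 3 is fixed by both contractions, abscissa 2
      -- by `phi₁` and abscissa -1 by `phi₂`.
      refine ⟨by linarith, by linarith, ?_, ?_, fun h => by linarith⟩ <;>
        rcases hη with rfl | rfl <;> linarith

/-- The part of the table that is not in the polygon `Ω(𝒯₀)`. -/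
theorem mem_baseTable_or_of_mem_table {n : ℕ} {z : ℂ} (hz : z ∈ table n) :
    z ∈ baseTable ∨ (3 / 2 ≤ z.im ∧ (z.im < 2 → z.re ≤ 0 ∨ 1 ≤ z.re)) := by
  cases n with
  | zero => rw [table_zero] at hz; exact Or.inl hz
  | succ n =>
    rw [table_succ] at hz
    refine hz.imp_right fun hz => ?_
    obtain ⟨η, hη, hz⟩ := mem_Phi.1 hz
    obtain ⟨h1, -, -, -, h2⟩ := bounds_of_mem_table hz
    rw [expansion_im] at h1 h2
    rw [expansion_re] at h2
    refine ⟨by linarith, fun h => ?_⟩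
    obtain ⟨h3, h4⟩ := h2 (by linarith)
    rcases hη with rfl | rfl
    · exact Or.inr (by linarith)
    · exact Or.inl (by linarith)

theorem removedSegments_succ (n : ℕ) : removedSegments (n + 1) = Phi (removedSegments n) := by
  rw [removedSegments, Function.iterate_succ_apply']; rfl

theorem mem_base {z : ℂ} : z ∈ base ↔ (0 ≤ z.re ∧ z.re ≤ 1) ∧ z.im = 0 := by
  rw [base, segment_eq_image']
  constructor
  · rintro ⟨t, ht, rfl⟩
    simpa using ht
  · rintro ⟨h1, h2⟩
    exact ⟨z.re, h1, Complex.ext (by simp) (by simp [h2])⟩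

theorem base_subset_table (n : ℕ) : base ⊆ table n := fun z hz =>
  baseTable_subset_table n (Or.inl ⟨(mem_base.1 hz).1, by
    rw [Set.mem_preimage, (mem_base.1 hz).2]; norm_num⟩)

/-- Removed segments lie in the two children, apart from the middle of the top side. -/
theorem bounds_of_mem_removedSegments {n : ℕ} {z : ℂ} (hz : z ∈ removedSegments n) :
    -1 < z.re ∧ z.re < 2 ∧ 3 / 2 ≤ z.im ∧ (z.im = 3 / 2 → z.re ≤ 0 ∨ 1 ≤ z.re) := by
  induction n generalizing z with
  | zero =>
    obtain ⟨η, hη, hz⟩ := mem_Phi.1 (show z ∈ Phi base from hz)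
    obtain ⟨⟨h1, h2⟩, h3⟩ := mem_base.1 hz
    rw [expansion_im] at h3
    rw [expansion_re] at h1 h2
    rcases hη with rfl | rfl
    · exact ⟨by linarith, by linarith, by linarith, fun _ => Or.inr (by linarith)⟩
    · exact ⟨by linarith, by linarith, by linarith, fun _ => Or.inl (by linarith)⟩
  | succ n ih =>
    rw [removedSegments_succ] at hz
    obtain ⟨η, hη, hz⟩ := mem_Phi.1 hz
    obtain ⟨h1, h2, h3, -⟩ := ih hz
    rw [expansion_im] at h3
    rw [expansion_re] at h1 h2
    refine ⟨?_, ?_, by linarith, fun h => by linarith⟩ <;> rcases hη with rfl | rfl <;> linarith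

/-! ### The local structure of the tables -/

theorem eventually_re_mem {z : ℂ} {a b : ℝ} (h : a < z.re) (h' : z.re < b) :
    ∀ᶠ w in 𝓝 z, a < w.re ∧ w.re < b :=
  (Complex.continuous_re.continuousAt.eventually_const_lt h).and
    (Complex.continuous_re.continuousAt.eventually_lt_const h')

theorem eventually_im_mem {z : ℂ} {a b : ℝ} (h : a < z.im) (h' : z.im < b) :
    ∀ᶠ w in 𝓝 z, a < w.im ∧ w.im < b :=
  (Complex.continuous_im.continuousAt.eventually_const_lt h).and
    (Complex.continuous_im.continuousAt.eventually_lt_const h')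

theorem OnHorizontalSide.mem_frontier {Ω : Set ℂ} {z : ℂ} (h : OnHorizontalSide Ω z) :
    z ∈ frontier Ω := by
  rw [frontier_eq_closure_inter_closure]
  refine ⟨subset_closure ?_, ?_⟩
  · rcases h with h | h
    · exact h.self_of_nhds.2 le_rfl
    · exact h.self_of_nhds.2 le_rfl
  · rw [mem_closure_iff_frequently]
    intro hc
    rcases h with h | h <;>
    · obtain ⟨t, ht, ⟨h1, h2⟩, h3, h4⟩ := eventually_line (h.and hc) Complex.I
      simp at h1 h2 h3 h4
      first
        | linarith [h3.1 h4]
        | linarith [h1.1 h2]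

theorem OnVerticalSide.mem_frontier {Ω : Set ℂ} {z : ℂ} (h : OnVerticalSide Ω z) :
    z ∈ frontier Ω := by
  rw [frontier_eq_closure_inter_closure]
  refine ⟨subset_closure ?_, ?_⟩
  · rcases h with h | h
    · exact h.self_of_nhds.2 le_rfl
    · exact h.self_of_nhds.2 le_rfl
  · rw [mem_closure_iff_frequently]
    intro hc
    rcases h with h | h <;>
    · obtain ⟨t, ht, ⟨h1, h2⟩, h3, h4⟩ := eventually_line (h.and hc) 1
      simp at h1 h2 h3 h4
      first
        | linarith [h3.1 h4]
        | linarith [h1.1 h2]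

/-- `Ω` contains the open rectangle with centre line `re = 1/2`, width `w` and heights between
`h₀` and `h₁`, and the vertical sides of this rectangle are in sides of `Ω` and avoid `R`. -/
structure HasChannel (Ω R : Set ℂ) (w h₀ h₁ : ℝ) : Prop where
  inside : ∀ z : ℂ, |z.re - 1 / 2| < w / 2 → h₀ < z.im → z.im < h₁ → z ∈ interior Ω
  wall : ∀ z : ℂ, |z.re - 1 / 2| = w / 2 → h₀ < z.im → z.im < h₁ → OnVerticalSide Ω z ∧ z ∉ R

/-- Up to the line `im = 3/2`, and apart from the segments to be removed, `Ω` is locally the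
polygon `Ω(𝒯₀)`. -/
structure IsLocallyBaseTable (Ω R : Set ℂ) : Prop where
  stem : HasChannel Ω R 1 0 1
  bar : HasChannel Ω R 2 1 (3 / 2)
  throat : ∀ z : ℂ, |z.re - 1 / 2| < 1 / 2 → z.im = 1 → z ∈ interior Ω
  top : ∀ z : ℂ, |z.re - 1 / 2| < 1 / 2 → z.im = 3 / 2 → OnHorizontalSide Ω z ∧ z ∉ R
  wing : ∀ z : ℂ, 1 / 2 < |z.re - 1 / 2| → |z.re - 1 / 2| < 1 → z.im = 1 →
    OnHorizontalSide Ω z ∧ z ∉ R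

/-- Where a trajectory that escapes must not collide: on removed segments and on the base line. -/
def forbidden (n : ℕ) : Set ℂ := removedSegments n ∪ {z | z.im ≤ 0}

theorem not_mem_forbidden {n : ℕ} {z : ℂ} (h0 : 0 < z.im)
    (h : z.im < 3 / 2 ∨ z.im = 3 / 2 ∧ |z.re - 1 / 2| < 1 / 2) : z ∉ forbidden n := by
  rintro (hz | hz)
  · obtain ⟨-, -, h1, h2⟩ := bounds_of_mem_removedSegments hz
    rcases h with h | ⟨h, h'⟩
    · linarith
    · rw [abs_lt] at h'
      rcases h2 h with h2 | h2 <;> linarith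
  · exact absurd hz (not_le.2 h0)

/-- The children start at height `3/2` and, up to height 2, leave the strip `0 < re < 1` free. So
the local picture is the same for all `n`. -/
theorem isLocallyBaseTable_table (n : ℕ) : IsLocallyBaseTable (table n) (forbidden n) := by
  have hlow : ∀ {z : ℂ}, z.im < 3 / 2 → (z ∈ table n ↔ z ∈ baseTable) := fun {z} hz =>
    ⟨fun h => (mem_baseTable_or_of_mem_table h).resolve_right fun h' => by linarith,
      fun h => baseTable_subset_table n h⟩
  refine ⟨⟨?_, ?_⟩, ⟨?_, ?_⟩, ?_, ?_, ?_⟩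
  · intro z h1 h2 h3
    rw [abs_lt] at h1
    rw [mem_interior_iff_mem_nhds]
    filter_upwards [eventually_re_mem (z := z) (a := 0) (b := 1) (by linarith) (by linarith),
      eventually_im_mem h2 h3] with w hw hw'
    exact baseTable_subset_table n (mem_baseTable.2 (Or.inl ⟨⟨hw.1.le, hw.2.le⟩, hw'.1.le,
      hw'.2.le⟩))
  · intro z h1 h2 h3
    refine ⟨?_, not_mem_forbidden h2 (Or.inl (by linarith))⟩
    rcases (abs_eq (by norm_num)).1 h1 with h1 | h1
    · right
      filter_upwards [eventually_re_mem (z := z) (a := 0) (b := 2) (by linarith) (by linarith),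
        eventually_im_mem h2 h3] with w hw hw'
      rw [hlow (by linarith), mem_baseTable]
      constructor
      · rintro (h | h) <;> linarith
      · exact fun h => Or.inl ⟨⟨by linarith, by linarith⟩, by linarith, by linarith⟩
    · left
      filter_upwards [eventually_re_mem (z := z) (a := -1) (b := 1) (by linarith) (by linarith),
        eventually_im_mem h2 h3] with w hw hw'
      rw [hlow (by linarith), mem_baseTable]
      constructor
      · rintro (h | h) <;> linarith
      · exact fun h => Or.inl ⟨⟨by linarith, by linarith⟩, by linarith, by linarith⟩
  · intro z h1 h2 h3
    rw [abs_lt] at h1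
    rw [mem_interior_iff_mem_nhds]
    filter_upwards [eventually_re_mem (z := z) (a := -1 / 2) (b := 3 / 2) (by linarith)
      (by linarith), eventually_im_mem h2 h3] with w hw hw'
    exact baseTable_subset_table n (mem_baseTable.2 (Or.inr ⟨⟨hw.1.le, hw.2.le⟩, hw'.1.le,
      hw'.2.le⟩))
  · intro z h1 h2 h3
    refine ⟨?_, not_mem_forbidden (by linarith) (Or.inl (by linarith))⟩
    rcases (abs_eq (by norm_num)).1 h1 with h1 | h1
    · right
      filter_upwards [eventually_re_mem (z := z) (a := 1) (b := 2) (by linarith) (by linarith),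
        eventually_im_mem h2 h3] with w hw hw'
      rw [hlow (by linarith), mem_baseTable]
      constructor
      · rintro (h | h) <;> linarith
      · exact fun h => Or.inr ⟨⟨by linarith, by linarith⟩, by linarith, by linarith⟩
    · left
      filter_upwards [eventually_re_mem (z := z) (a := -1) (b := 0) (by linarith) (by linarith),
        eventually_im_mem h2 h3] with w hw hw'
      rw [hlow (by linarith), mem_baseTable]
      constructor
      · rintro (h | h) <;> linarith
      · exact fun h => Or.inr ⟨⟨by linarith, by linarith⟩, by linarith, by linarith⟩
  · intro z h1 h2
    rw [abs_lt] at h1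
    rw [mem_interior_iff_mem_nhds]
    filter_upwards [eventually_re_mem (z := z) (a := 0) (b := 1) (by linarith) (by linarith),
      eventually_im_mem (z := z) (a := 0) (b := 3 / 2) (by linarith) (by linarith)] with w hw hw'
    refine baseTable_subset_table n (mem_baseTable.2 ?_)
    rcases le_total w.im 1 with h | h
    · exact Or.inl ⟨⟨hw.1.le, hw.2.le⟩, hw'.1.le, h⟩
    · exact Or.inr ⟨⟨by linarith, by linarith⟩, h, hw'.2.le⟩
  · intro z h1 h2
    refine ⟨Or.inr ?_, not_mem_forbidden (by linarith) (Or.inr ⟨h2, h1⟩)⟩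
    rw [abs_lt] at h1
    filter_upwards [eventually_re_mem (z := z) (a := 0) (b := 1) (by linarith) (by linarith),
      eventually_im_mem (z := z) (a := 1) (b := 2) (by linarith) (by linarith)] with w hw hw'
    constructor
    · intro h
      rcases mem_baseTable_or_of_mem_table h with h | ⟨-, h⟩
      · rw [mem_baseTable] at h
        rcases h with h | h <;> linarith
      · rcases h hw'.2 with h | h <;> linarith
    · exact fun h => baseTable_subset_table n (mem_baseTable.2 (Or.inr
        ⟨⟨by linarith, by linarith⟩, by linarith, by linarith⟩))
  · intro z h1 h2 h3
    refine ⟨Or.inl ?_, not_mem_forbidden (by linarith) (Or.inl (by linarith))⟩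
    rw [abs_lt] at h2
    have hside : ∀ᶠ w in 𝓝 z, 1 / 2 < |w.re - 1 / 2| :=
      (show Continuous fun w : ℂ => |w.re - 1 / 2| by fun_prop).continuousAt.eventually_const_lt h1
    filter_upwards [eventually_re_mem (z := z) (a := -1 / 2) (b := 3 / 2) (by linarith)
      (by linarith), hside, eventually_im_mem (z := z) (a := 0) (b := 3 / 2) (by linarith)
      (by linarith)] with w hw hw1 hw'
    rw [hlow (by linarith), mem_baseTable]
    constructor
    · rintro (h | h)
      · have : |w.re - 1 / 2| ≤ 1 / 2 := abs_le.2 ⟨by linarith, by linarith⟩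
        linarith
      · linarith
    · exact fun h => Or.inr ⟨⟨by linarith, by linarith⟩, by linarith, by linarith⟩

/-- The base of the table. -/
theorem onHorizontalSide_base {n : ℕ} {z : ℂ} (h : |z.re - 1 / 2| < 1 / 2) (h' : z.im = 0) :
    OnHorizontalSide (table n) z := by
  left
  rw [abs_lt] at h
  filter_upwards [eventually_re_mem (z := z) (a := 0) (b := 1) (by linarith) (by linarith),
    eventually_im_mem (z := z) (a := -1) (b := 1) (by linarith) (by linarith)] with w hw hw'
  constructor
  · intro hz
    linarith [(bounds_of_mem_table hz).1]
  · exact fun hz => baseTable_subset_table n (mem_baseTable.2 (Or.inl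
      ⟨⟨by linarith, by linarith⟩, by linarith, by linarith⟩))

/-- The segments to be removed from `Ω(𝒯₀)` are in its horizontal sides. -/
theorem onHorizontalSide_exit {η : ℝ} (hη : η = 1 ∨ η = -1) {z : ℂ} (h : |z.re - 1 / 2| < 1 / 2)
    (h' : z.im = 0) : OnHorizontalSide (table 0) (contraction η z) := by
  right
  rw [abs_lt] at h
  have hre : -1 / 2 < (contraction η z).re ∧ (contraction η z).re < 3 / 2 := by
    rw [contraction_re]
    rcases hη with rfl | rfl <;> constructor <;> linarith
  filter_upwards [eventually_re_mem hre.1 hre.2,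
    eventually_im_mem (z := contraction η z) (a := 1) (b := 2) (by rw [contraction_im]; linarith)
    (by rw [contraction_im]; linarith)] with w hw hw'
  rw [table_zero, mem_baseTable, contraction_im, h']
  constructor
  · rintro (h | h) <;> linarith
  · exact fun hz => Or.inr ⟨⟨by linarith, by linarith⟩, by linarith, by linarith⟩

/-- The removed segments are in the interior of the next table. -/
theorem contraction_mem_interior {n : ℕ} {η : ℝ} (hη : η = 1 ∨ η = -1) {z : ℂ}
    (h : |z.re - 1 / 2| < 1 / 2) (h' : z.im = 0) :
    contraction η z ∈ interior (table (n + 1)) := by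
  rw [abs_lt] at h
  rw [mem_interior_iff_mem_nhds]
  have hre : 1 / 4 + η * (3 / 4) < (contraction η z).re ∧
      (contraction η z).re < 1 / 2 + (1 / 4 + η * (3 / 4)) := by
    rw [contraction_re]; constructor <;> linarith
  filter_upwards [eventually_re_mem hre.1 hre.2,
    eventually_im_mem (z := contraction η z) (a := 1) (b := 2) (by rw [contraction_im]; linarith)
    (by rw [contraction_im]; linarith)] with w hw hw'
  rcases le_total w.im (3 / 2) with hle | hle
  · refine baseTable_subset_table _ (mem_baseTable.2 (Or.inr ⟨?_, by linarith, by linarith⟩))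
    rcases hη with rfl | rfl <;> constructor <;> linarith
  · rw [table_succ]
    refine Or.inr (mem_Phi.2 ⟨η, hη, baseTable_subset_table n (mem_baseTable.2 (Or.inl ?_))⟩)
    rw [expansion_re, expansion_im]
    exact ⟨⟨by linarith, by linarith⟩, by linarith, by linarith⟩

/-- Away from its base, the copy of `Ω(𝒯ₙ)` is locally all of `Ω(𝒯ₙ₊₁)`. -/
theorem eventually_mem_table_succ {n : ℕ} {η : ℝ} (hη : η = 1 ∨ η = -1) {z : ℂ} (hz : z ∈ table n)
    (h0 : 0 < z.im) :
    ∀ᶠ w in 𝓝 (contraction η z), w ∈ table (n + 1) ↔ expansion η w ∈ table n := by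
  obtain ⟨-, -, hre1, hre2, -⟩ := bounds_of_mem_table hz
  -- This window is `(1/2, 2)` for `η = 1` and `(-1, 1/2)` for `η = -1`: the line `re = 1/2`
  -- separates the two copies. Heights above `3/2` exclude `baseTable`.
  have hre : 1 / 4 + η * (3 / 4) - 1 / 2 < (contraction η z).re ∧
      (contraction η z).re < 1 + (1 / 4 + η * (3 / 4)) := by
    rw [contraction_re]; constructor <;> linarith
  filter_upwards [eventually_re_mem hre.1 hre.2, eventually_im_mem (z := contraction η z)
    (a := 3 / 2) (b := z.im + 2) (by rw [contraction_im]; linarith)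
    (by rw [contraction_im]; linarith)] with w hw hw'
  rw [table_succ]
  constructor
  · rintro (h | h)
    · rw [mem_baseTable] at h
      rcases h with h | h <;> linarith
    · obtain ⟨η', hη', h⟩ := mem_Phi.1 h
      suffices η' = η by rwa [← this]
      obtain ⟨-, -, h1, h2, -⟩ := bounds_of_mem_table h
      rw [expansion_re] at h1 h2
      rcases hη with rfl | rfl <;> rcases hη' with rfl | rfl <;> first | rfl | linarith
  · exact fun h => Or.inr (mem_Phi.2 ⟨η, hη, h⟩)

theorem eventually_expansion {η : ℝ} {z : ℂ} {p : ℂ → Prop} (h : ∀ᶠ w in 𝓝 z, p w) :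
    ∀ᶠ w in 𝓝 (contraction η z), p (expansion η w) := by
  have := (continuous_expansion η).tendsto (contraction η z)
  rw [expansion_contraction] at this
  exact this.eventually h

section Embedding

variable {n : ℕ} {η : ℝ} {z : ℂ}

theorem OnHorizontalSide.contraction (hη : η = 1 ∨ η = -1) (h0 : 0 < z.im)
    (h : OnHorizontalSide (table n) z) : OnHorizontalSide (table (n + 1)) (contraction η z) := by
  have hz := (isClosed_table n).frontier_subset h.mem_frontier
  refine h.imp (fun h => ?_) fun h => ?_ <;>
  · filter_upwards [eventually_mem_table_succ hη hz h0, eventually_expansion h] with w h1 h2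
    rw [h1, h2, expansion_im, contraction_im]
    constructor <;> intro <;> linarith

theorem OnVerticalSide.contraction (hη : η = 1 ∨ η = -1) (h0 : 0 < z.im)
    (h : OnVerticalSide (table n) z) : OnVerticalSide (table (n + 1)) (contraction η z) := by
  have hz := (isClosed_table n).frontier_subset h.mem_frontier
  refine h.imp (fun h => ?_) fun h => ?_ <;>
  · filter_upwards [eventually_mem_table_succ hη hz h0, eventually_expansion h] with w h1 h2
    rw [h1, h2, expansion_re, contraction_re]
    constructor <;> intro <;> linarith

theorem IsRightAngle.contraction (hη : η = 1 ∨ η = -1) (hz : z ∈ table n) (h0 : 0 < z.im)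
    (h : IsRightAngle (table n) z) : IsRightAngle (table (n + 1)) (contraction η z) := by
  obtain ⟨a, b, ha, hb, h⟩ := h
  refine ⟨2 * a, 2 * b, by simpa, by simpa, ?_⟩
  filter_upwards [eventually_mem_table_succ hη hz h0, eventually_expansion h] with w h1 h2
  rw [h1, h2, expansion_re, contraction_re, expansion_im, contraction_im]
  ring_nf

theorem interior_contraction (hη : η = 1 ∨ η = -1) (h : z ∈ interior (table n)) :
    contraction η z ∈ interior (table (n + 1)) := by
  rw [mem_interior_iff_mem_nhds] at h ⊢
  filter_upwards [eventually_expansion h] with w hw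
  rw [table_succ]
  exact Or.inr (mem_Phi.2 ⟨η, hη, hw⟩)

theorem frontier_contraction (hη : η = 1 ∨ η = -1) (h0 : 0 < z.im)
    (h : z ∈ frontier (table n)) : contraction η z ∈ frontier (table (n + 1)) := by
  have hz := (isClosed_table n).frontier_subset h
  have hev := eventually_mem_table_succ hη hz h0
  refine ⟨subset_closure (hev.self_of_nhds.2 (by simpa using hz)), fun hint => h.2 ?_⟩
  rw [mem_interior_iff_mem_nhds] at hint ⊢
  have h1 := (continuous_contraction η).continuousAt.eventually
    (hev.and (show ∀ᶠ w in 𝓝 (TFractal.contraction η z), w ∈ table (n + 1) from hint))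
  filter_upwards [h1] with w hw
  simpa using hw.1.1 hw.2

theorem removedSegments_of_contraction (hη : η = 1 ∨ η = -1) (hz : z ∈ table n)
    (h : contraction η z ∈ removedSegments (n + 1)) : z ∈ removedSegments n := by
  rw [removedSegments_succ] at h
  obtain ⟨η', hη', h⟩ := mem_Phi.1 h
  suffices η' = η by simpa [this] using h
  obtain ⟨-, -, h1, h2, -⟩ := bounds_of_mem_table hz
  obtain ⟨h3, h4, -⟩ := bounds_of_mem_removedSegments h
  rw [expansion_re, contraction_re] at h3 h4
  rcases hη with rfl | rfl <;> rcases hη' with rfl | rfl <;> first | rfl | linarith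

/-- The image of the state `s` in the copy of the table. -/
noncomputable def contractState (η : ℝ) (s : ℂ × ℂ) : ℂ × ℂ := (contraction η s.1, s.2)

/-- Directions are kept and lengths halved, so time `t` in the copy is time `2 * t` in the original.
-/
theorem contraction_add_smul (η t : ℝ) (z v : ℂ) :
    contraction η z + t • v = contraction η (z + (2 * t) • v) := by
  simp only [TFractal.contraction, Complex.real_smul]
  push_cast
  ring

theorem Approach.contraction (hη : η = 1 ∨ η = -1) {s s' : ℂ × ℂ} (h : Approach (table n) s s') :
    Approach (table (n + 1)) (contractState η s) (contractState η s') := by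
  obtain ⟨hv, t, ht, he, hi⟩ := h
  refine ⟨hv, t / 2, by positivity, ?_, ?_⟩
  · simp only [contractState, he, contraction_add_smul]
    ring_nf
  · rintro u ⟨hu, hu'⟩
    simp only [contractState, contraction_add_smul]
    exact interior_contraction hη (hi _ ⟨by linarith, by linarith⟩)

theorem BilliardStep.contraction (hη : η = 1 ∨ η = -1) {s s' : ℂ × ℂ} (h0 : 0 < s'.1.im)
    (h : BilliardStep (table n) s s') :
    BilliardStep (table (n + 1)) (contractState η s) (contractState η s') := by
  have ha := h.approach.contraction hη
  obtain ⟨t, ht, he, hi, hf, hr⟩ := h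
  refine ha.billiardStep (frontier_contraction hη h0 hf) ?_
  rcases hr with ⟨h1, h2⟩ | ⟨h1, h2⟩ | ⟨h1, h2⟩
  · exact Or.inl ⟨h1.contraction hη h0, h2⟩
  · exact Or.inr (Or.inl ⟨h1.contraction hη h0, h2⟩)
  · exact Or.inr (Or.inr
      ⟨h1.contraction hη ((isClosed_table n).frontier_subset hf) h0, h2⟩)

theorem image_contraction_segment (η : ℝ) (x y : ℂ) :
    TFractal.contraction η '' segment ℝ x y =
      segment ℝ (TFractal.contraction η x) (TFractal.contraction η y) := by
  simp only [segment_eq_image', Set.image_image]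
  refine Set.image_congr fun t _ => ?_
  simp only [TFractal.contraction, Complex.real_smul]
  ring

/-- This is why `forbidden` contains the lower half-plane: a collision on the base of the copy would
be no collision in the larger table. -/
theorem Trajectory.contraction (hη : η = 1 ∨ η = -1) {s s' : ℂ × ℂ} {P : Set ℂ}
    (h : Trajectory (table n) (forbidden n) s s' P) :
    Trajectory (table (n + 1)) (forbidden (n + 1)) (contractState η s) (contractState η s')
      (TFractal.contraction η '' P) := by
  induction h with
  | approach h => rw [image_contraction_segment]; exact .approach (h.contraction hη)
  | step h hR _ ih =>
    rw [Set.image_union, image_contraction_segment]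
    refine .step (h.contraction hη (not_le.1 fun hle => hR (Or.inr hle))) ?_ ih
    rintro (hmem | hmem)
    · obtain ⟨t, -, -, -, hf, -⟩ := h
      exact hR (Or.inl (removedSegments_of_contraction hη
        ((isClosed_table n).frontier_subset hf) hmem))
    · refine hR (Or.inr ?_)
      simp only [contractState, Set.mem_ofPred_eq, contraction_im] at hmem ⊢
      linarith

end Embedding


/-! ### Trajectories of slope `± 1 / p` in a channel -/

/-- The point at height `y` and at signed distance `s` from the line `re = 1/2`, measured in the
horizontal direction `ε = ±1`. -/
noncomputable def axisPoint (ε s y : ℝ) : ℂ := ⟨1 / 2 + ε * s, y⟩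

/-- The velocity with horizontal direction `ε` and vertical direction `σ`, of slope `± 1 / p`. -/
noncomputable def velocity (c p ε σ : ℝ) : ℂ := ⟨c * (ε * p), c * σ⟩

@[simp] theorem axisPoint_re (ε s y : ℝ) : (axisPoint ε s y).re = 1 / 2 + ε * s := rfl
@[simp] theorem axisPoint_im (ε s y : ℝ) : (axisPoint ε s y).im = y := rfl

theorem axisPoint_add_smul (c p ε s y σ u : ℝ) :
    axisPoint ε s y + u • velocity c p ε σ = axisPoint ε (s + p * (c * u)) (y + σ * (c * u)) := by
  apply Complex.ext <;> simp [axisPoint, velocity] <;> ring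

theorem abs_axisPoint {ε : ℝ} (hε : ε = 1 ∨ ε = -1) (s y : ℝ) :
    |(axisPoint ε s y).re - 1 / 2| = |s| := by
  rw [axisPoint_re, add_sub_cancel_left]
  rcases hε with rfl | rfl <;> simp

theorem reflects_vertical {Ω : Set ℂ} {z : ℂ} (h : OnVerticalSide Ω z) (c p ε σ : ℝ) :
    Reflects Ω z (velocity c p ε σ) (velocity c p (-ε) σ) :=
  Or.inr (Or.inl ⟨h, by apply Complex.ext <;> simp [velocity]⟩)

theorem reflects_horizontal {Ω : Set ℂ} {z : ℂ} (h : OnHorizontalSide Ω z) (c p ε σ : ℝ) :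
    Reflects Ω z (velocity c p ε σ) (velocity c p ε (-σ)) :=
  Or.inl ⟨h, by apply Complex.ext <;> simp [velocity]⟩

theorem HasChannel.approach {Ω R : Set ℂ} {c p w h₀ h₁ ε σ s y H : ℝ}
    (hch : HasChannel Ω R w h₀ h₁) (hc : 0 < c) (hp : 0 < p) (hε : ε = 1 ∨ ε = -1)
    (hσ : σ = 1 ∨ σ = -1) (hs : -(w / 2) ≤ s) (hs' : s + p * H ≤ w / 2) (hH : 0 < H)
    (hy : h₀ ≤ y ∧ y ≤ h₁) (hy' : h₀ ≤ y + σ * H ∧ y + σ * H ≤ h₁) :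
    Approach Ω (axisPoint ε s y, velocity c p ε σ)
      (axisPoint ε (s + p * H) (y + σ * H), velocity c p ε σ) := by
  refine ⟨rfl, H / c, by positivity, ?_, ?_⟩
  · rw [axisPoint_add_smul, mul_div_cancel₀ _ hc.ne']
  · rintro u ⟨hu, hu'⟩
    rw [lt_div_iff₀ hc, mul_comm] at hu'
    have hcu : 0 < c * u := by positivity
    have h1 : p * (c * u) < p * H := by gcongr
    have h2 : 0 < p * (c * u) := by positivity
    dsimp only
    rw [axisPoint_add_smul]
    refine hch.inside _ ?_ ?_ ?_
    · rw [abs_axisPoint hε, abs_lt]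
      constructor <;> linarith
    · rw [axisPoint_im]
      rcases hσ with rfl | rfl <;> linarith
    · rw [axisPoint_im]
      rcases hσ with rfl | rfl <;> linarith

/-- A ball that moves in a channel through the vertical distance `H` arrives at the point that is
obtained by folding the straight line; `k` is the number of collisions with the walls. -/
theorem exists_transit {c p w h₀ h₁ σ : ℝ} (hc : 0 < c) (hp : 0 < p) (hw : 0 < w)
    (hσ : σ = 1 ∨ σ = -1) {ε s y H : ℝ} (hε : ε = 1 ∨ ε = -1) (hs : -(w / 2) ≤ s) (hsw : s < w / 2)
    (hH : 0 < H) (hy : h₀ ≤ y ∧ y ≤ h₁) (hy' : h₀ ≤ y + σ * H ∧ y + σ * H ≤ h₁) :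
    ∃ (k : ℕ) (P : Set ℂ), |s + p * H - k * w| ≤ w / 2 ∧
      ∀ Ω R, HasChannel Ω R w h₀ h₁ →
        Trajectory Ω R (axisPoint ε s y, velocity c p ε σ)
          (axisPoint ((-1) ^ k * ε) (s + p * H - k * w) (y + σ * H),
            velocity c p ((-1) ^ k * ε) σ) P := by
  -- Induction on a bound `m` for the unfolded distance from the rear wall, in units of `w`; each
  -- wall hit uses up one unit, and `m = 0` is impossible.
  obtain ⟨m, hm⟩ : ∃ m : ℕ, s + w / 2 + p * H ≤ m * w := by
    obtain ⟨m, hm⟩ := exists_nat_ge ((s + w / 2 + p * H) / w)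
    exact ⟨m, (div_le_iff₀ hw).1 hm⟩
  induction m generalizing ε s y H with
  | zero =>
    have : 0 < p * H := by positivity
    simp only [Nat.cast_zero, zero_mul] at hm
    linarith
  | succ m ih =>
    rcases le_or_gt (s + p * H) (w / 2) with hle | hgt
    · have : 0 < p * H := by positivity
      refine ⟨0, segment ℝ (axisPoint ε s y) (axisPoint ε (s + p * H) (y + σ * H)), ?_,
        fun Ω R hch => ?_⟩
      · simp only [Nat.cast_zero, zero_mul, sub_zero]
        exact abs_le.2 ⟨by linarith, hle⟩
      · have := hch.approach hc hp hε hσ hs hle hH hy hy'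
        simp only [pow_zero, one_mul, Nat.cast_zero, zero_mul, sub_zero]
        exact .approach this
    -- `H₀` is the vertical distance covered before the next wall hit.
    · set H₀ := (w / 2 - s) / p with hH₀
      have hpH₀ : p * H₀ = w / 2 - s := by rw [hH₀]; field_simp
      have hH₀pos : 0 < H₀ := div_pos (by linarith) hp
      have hH₀lt : H₀ < H := by rw [hH₀, div_lt_iff₀ hp]; linarith
      have hmid : h₀ < y + σ * H₀ ∧ y + σ * H₀ < h₁ := by
        rcases hσ with rfl | rfl <;> constructor <;> linarith
      have hrest : p * (H - H₀) = p * H - w / 2 + s := by rw [mul_sub, hpH₀]; ring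
      have hend : y + σ * H₀ + σ * (H - H₀) = y + σ * H := by ring
      push_cast at hm
      obtain ⟨k, P, hk, hP⟩ := ih (ε := -ε) (s := -(w / 2)) (y := y + σ * H₀) (H := H - H₀)
        (by rcases hε with rfl | rfl <;> simp) le_rfl (by linarith) (by linarith)
        ⟨hmid.1.le, hmid.2.le⟩ (by rwa [hend]) (by rw [hrest]; linarith)
      have hpos : -(w / 2) + p * (H - H₀) - k * w = s + p * H - ((k + 1 : ℕ) : ℝ) * w := by
        rw [hrest]; push_cast; ring
      have hsign : (-1) ^ k * -ε = (-1) ^ (k + 1) * ε := by ring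
      rw [hpos] at hk
      refine ⟨k + 1, segment ℝ (axisPoint ε s y) (axisPoint (-ε) (-(w / 2)) (y + σ * H₀)) ∪ P, hk,
        fun Ω R hch => ?_⟩
      have h1 := hP Ω R hch
      rw [hpos, hend, hsign] at h1
      have h2 := hch.approach hc hp hε hσ hs (by rw [hpH₀]; linarith) hH₀pos hy
        ⟨hmid.1.le, hmid.2.le⟩
      -- The wall ahead, at `w / 2` in direction `ε`, is the wall behind, at `-(w / 2)`, once the
      -- direction is reversed.
      have hwall : axisPoint ε (s + p * H₀) (y + σ * H₀) =
          axisPoint (-ε) (-(w / 2)) (y + σ * H₀) := by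
        rw [hpH₀]; apply Complex.ext <;> simp
      rw [hwall] at h2
      obtain ⟨hside, hR⟩ := hch.wall (axisPoint (-ε) (-(w / 2)) (y + σ * H₀))
        (by rw [abs_axisPoint (by rcases hε with rfl | rfl <;> simp), abs_neg,
              abs_of_pos (by positivity)]) hmid.1 hmid.2
      exact Trajectory.bounce (.approach h2) hside.mem_frontier hR
        (reflects_vertical hside c p ε σ) h1

/-! ### The passage through a copy of `Ω(𝒯₀)` -/

/-- `s` is not a dyadic rational. -/
def NonDyadic (s : ℝ) : Prop := ∀ (m : ℤ) (l : ℕ), s ≠ m / 2 ^ l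

theorem NonDyadic.add_half {s : ℝ} (h : NonDyadic s) (j : ℤ) : NonDyadic (s + j / 2) := by
  intro m l hml
  refine h (2 * m - j * 2 ^ l) (l + 1) ?_
  rw [← eq_sub_iff_add_eq] at hml
  rw [hml, pow_succ]
  push_cast
  field_simp

theorem NonDyadic.two_mul {s : ℝ} (h : NonDyadic s) : NonDyadic (2 * s) := by
  intro m l hml
  refine h m (l + 1) ?_
  rw [pow_succ, ← div_div, ← hml]
  ring

theorem NonDyadic.ne_half {s : ℝ} (h : NonDyadic s) (j : ℤ) : s ≠ j / 2 := by
  simpa using h j 1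

/-- The state of a ball that enters a copy of `Ω(𝒯₀)` through its base: the horizontal direction
and the position on the base, relative to its centre and in this direction. -/
structure EntryState where
  dir : ℝ
  pos : ℝ
  dir_eq : dir = 1 ∨ dir = -1
  abs_pos_lt : |pos| < 1 / 2
  nonDyadic : NonDyadic pos

/-- The point of the base. -/
noncomputable def EntryState.point (S : EntryState) : ℂ := axisPoint S.dir S.pos 0

/-- The ball moves upwards. -/
noncomputable def EntryState.state (c p : ℝ) (S : EntryState) : ℂ × ℂ :=
  (S.point, velocity c p S.dir 1)

theorem EntryState.abs_point (S : EntryState) : |S.point.re - 1 / 2| < 1 / 2 := by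
  rw [EntryState.point, abs_axisPoint S.dir_eq]
  exact S.abs_pos_lt

/-- A point in the outer part of the top side is on the base of a child. -/
theorem exists_entryState {ε s : ℝ} (hε : ε = 1 ∨ ε = -1) (hs : NonDyadic s) (h : 1 / 2 < |s|)
    (h' : |s| < 1) : ∃ (η : ℝ) (T : EntryState), (η = 1 ∨ η = -1) ∧ T.dir = ε ∧
      contraction η T.point = axisPoint ε s (3 / 2) := by
  obtain ⟨κ, hκ, hκs⟩ : ∃ κ : ℤ, (κ = 1 ∨ κ = -1) ∧ |s| = κ * s := by
    rcases abs_cases s with ⟨h, -⟩ | ⟨h, -⟩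
    · exact ⟨1, Or.inl rfl, by simpa using h⟩
    · exact ⟨-1, Or.inr rfl, by simpa using h⟩
  -- The base of a child has its centre at distance `3/4` from the axis and half the scale: solve `s
  -- = pos / 2 + 3 * κ / 4` for `pos`.
  refine ⟨ε * κ, ⟨ε, 2 * s + ((-3 * κ : ℤ) : ℝ) / 2, hε, ?_, hs.two_mul.add_half _⟩, ?_, rfl, ?_⟩
  · rw [hκs] at h h'
    rw [abs_lt]
    rcases hκ with rfl | rfl <;> push_cast at h h' ⊢ <;> constructor <;> linarith
  · rcases hκ with rfl | rfl <;> rcases hε with rfl | rfl <;> simp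
  · apply Complex.ext
    · simp only [contraction_re, EntryState.point, axisPoint_re]
      push_cast
      ring
    · simp [EntryState.point]

theorem contractState_state {c p η ε : ℝ} {z : ℂ} {T : EntryState} (hz : contraction η T.point = z)
    (hT : T.dir = ε) : contractState η (T.state c p) = (z, velocity c p ε 1) := by
  subst hz hT
  rfl

/-- Two numbers whose difference is an odd integer are not both of absolute value `< 1/2`. -/
theorem half_lt_abs_of_odd_sub {s s' : ℝ} {j : ℤ} (hj : Odd j) (h : s' - s = j) (hs : |s| < 1 / 2)
    (hs' : NonDyadic s') : 1 / 2 < |s'| := by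
  by_contra hle
  have hne : |s'| ≠ 1 / 2 := by
    intro heq
    rcases (abs_eq (by norm_num)).1 heq with h1 | h1
    · exact hs'.ne_half 1 (by rw [h1]; norm_num)
    · exact hs'.ne_half (-1) (by rw [h1]; norm_num)
  have hlt := lt_of_le_of_ne (not_lt.1 hle) hne
  rw [abs_lt] at hs hlt
  have h1 : (j : ℝ) < 1 := by linarith
  have h2 : (-1 : ℝ) < j := by linarith
  have h3 : j < 1 := by exact_mod_cast h1
  have h4 : -1 < j := by exact_mod_cast h2
  obtain ⟨i, rfl⟩ := hj
  omega

theorem sign_mul {ε : ℝ} (hε : ε = 1 ∨ ε = -1) (k : ℕ) :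
    (-1) ^ k * ε = 1 ∨ (-1) ^ k * ε = -1 := by
  rcases neg_one_pow_eq_or ℝ k with h | h <;> rcases hε with rfl | rfl <;> simp [h]

/-- The ball rises through the stem. -/
theorem exists_stem_transit {c : ℝ} (hc : 0 < c) {p : ℕ} (hp : Odd p) (S : EntryState) :
    ∃ P : Set ℂ, ∀ Ω R, IsLocallyBaseTable Ω R →
      Trajectory Ω R (S.state c p) (axisPoint (-S.dir) S.pos 1, velocity c p (-S.dir) 1) P := by
  have hs := abs_lt.1 S.abs_pos_lt
  obtain ⟨k, P, hk, hP⟩ := exists_transit (c := c) (p := p) (w := 1) (h₀ := 0) (h₁ := 1) (σ := 1)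
    (ε := S.dir) (s := S.pos) (y := 0) (H := 1) hc (by exact_mod_cast hp.pos) one_pos (Or.inl rfl)
    S.dir_eq hs.1.le hs.2 one_pos (by norm_num) (by norm_num)
  -- `|s + p - k| ≤ 1/2` and `|s| < 1/2` force `|p - k| < 1`; `p` wall hits, an odd number, reverse
  -- the direction.
  have hkp : k = p := by
    rw [abs_le] at hk
    have h1 : (p : ℝ) < k + 1 := by linarith
    have h2 : (k : ℝ) < p + 1 := by linarith
    have h3 : p < k + 1 := by exact_mod_cast h1
    have h4 : k < p + 1 := by exact_mod_cast h2
    omega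
  subst hkp
  refine ⟨P, fun Ω R h => ?_⟩
  simpa [hp.neg_one_pow, EntryState.state, EntryState.point] using hP Ω R h.stem

/-- The ball moves from one horizontal side of the bar to the other one. -/
theorem exists_bar_transit {c : ℝ} (hc : 0 < c) {p : ℕ} (hp : Odd p) {ε s y σ : ℝ}
    (hε : ε = 1 ∨ ε = -1) (hs : |s| < 1) (hnd : NonDyadic s)
    (hyσ : y = 1 ∧ σ = 1 ∨ y = 3 / 2 ∧ σ = -1) :
    ∃ (ε' s' : ℝ) (j : ℤ) (P : Set ℂ), (ε' = 1 ∨ ε' = -1) ∧ |s'| < 1 ∧ NonDyadic s' ∧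
      s' = s + p / 2 - 2 * j ∧ ∀ Ω R, IsLocallyBaseTable Ω R →
        Trajectory Ω R (axisPoint ε s y, velocity c p ε σ)
          (axisPoint ε' s' (y + σ * (1 / 2)), velocity c p ε' σ) P := by
  have hs := abs_lt.1 hs
  obtain ⟨k, P, hk, hP⟩ := exists_transit (c := c) (p := p) (w := 2) (h₀ := 1) (h₁ := 3 / 2)
    (σ := σ) (ε := ε) (s := s) (y := y) (H := 1 / 2) hc (by exact_mod_cast hp.pos) two_pos
    (by tauto) hε (by linarith) (by linarith) (by norm_num)
    (by rcases hyσ with ⟨rfl, rfl⟩ | ⟨rfl, rfl⟩ <;> norm_num)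
    (by rcases hyσ with ⟨rfl, rfl⟩ | ⟨rfl, rfl⟩ <;> norm_num)
  have hnd' : NonDyadic (s + p * (1 / 2) - k * 2) := by
    have := hnd.add_half (p - 4 * k)
    convert this using 1
    push_cast
    ring
  refine ⟨_, _, k, P, sign_mul hε k, ?_, hnd', by push_cast; ring, fun Ω R h => hP Ω R h.bar⟩
  rw [div_self two_ne_zero] at hk
  -- Equality would mean arrival in a corner of the bar, at a dyadic position.
  refine lt_of_le_of_ne hk fun heq => ?_
  rcases (abs_eq zero_le_one).1 heq with h1 | h1
  · exact hnd'.ne_half 2 (by rw [h1]; norm_num)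
  · exact hnd'.ne_half (-2) (by rw [h1]; norm_num)

/-- A ball that enters through the base leaves through the base of a child. -/
theorem exists_passage {c : ℝ} (hc : 0 < c) {p : ℕ} (hp : Odd p) (S : EntryState) :
    ∃ (η : ℝ) (T : EntryState) (P : Set ℂ), (η = 1 ∨ η = -1) ∧
      ∀ Ω R, IsLocallyBaseTable Ω R →
        Trajectory Ω R (S.state c p) (contractState η (T.state c p)) P := by
  have hodd : ∀ i j : ℤ, Odd ((p : ℤ) - 2 * i - 2 * j) := fun i j => by
    obtain ⟨q, rfl⟩ := hp
    exact ⟨q - i - j, by push_cast; ring⟩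
  obtain ⟨P₀, h₀⟩ := exists_stem_transit hc hp S
  have hdir : -S.dir = 1 ∨ -S.dir = -1 := by rcases S.dir_eq with h | h <;> simp [h]
  have hS : |(axisPoint (-S.dir) S.pos 1).re - 1 / 2| < 1 / 2 := by
    rw [abs_axisPoint hdir]; exact S.abs_pos_lt
  obtain ⟨ε₁, s₁, j₁, P₁, hε₁, hs₁, hn₁, he₁, h₁⟩ := exists_bar_transit hc hp hdir
    (by linarith [S.abs_pos_lt]) S.nonDyadic (Or.inl ⟨rfl, rfl⟩)
  norm_num only at h₁
  have hrise : ∀ Ω R, IsLocallyBaseTable Ω R → Trajectory Ω R (S.state c p)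
      (axisPoint ε₁ s₁ (3 / 2), velocity c p ε₁ 1) (P₀ ∪ P₁) := fun Ω R h =>
    (h₀ Ω R h).cross (h.throat _ hS rfl) (h₁ Ω R h)
  rcases lt_or_ge (1 / 2) |s₁| with hout | hin
  · obtain ⟨η, T, hη, hT, heq⟩ := exists_entryState hε₁ hn₁ hout hs₁
    refine ⟨η, T, P₀ ∪ P₁, hη, fun Ω R h => ?_⟩
    rw [contractState_state heq hT]
    exact hrise Ω R h
  -- Equality would be the inner end of the base of a child, again a dyadic position.
  have hin : |s₁| < 1 / 2 := by
    refine lt_of_le_of_ne hin fun heq => ?_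
    rcases (abs_eq (by norm_num)).1 heq with h1 | h1
    · exact hn₁.ne_half 1 (by rw [h1]; norm_num)
    · exact hn₁.ne_half (-1) (by rw [h1]; norm_num)
  obtain ⟨ε₂, s₂, j₂, P₂, hε₂, hs₂, hn₂, he₂, h₂⟩ := exists_bar_transit hc hp hε₁
    hs₁ hn₁ (Or.inr ⟨rfl, rfl⟩)
  norm_num only at h₂
  -- Two crossings of the bar shift by `p` modulo 2, an odd integer: the ball lands beside the stem.
  have hout₂ : 1 / 2 < |s₂| := half_lt_abs_of_odd_sub (hodd j₁ j₂)
    (by rw [he₂, he₁]; push_cast; ring) S.abs_pos_lt hn₂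
  obtain ⟨ε₃, s₃, j₃, P₃, hε₃, hs₃, hn₃, he₃, h₃⟩ := exists_bar_transit hc hp hε₂
    hs₂ hn₂ (Or.inl ⟨rfl, rfl⟩)
  norm_num only at h₃
  have hout₃ : 1 / 2 < |s₃| := half_lt_abs_of_odd_sub (hodd j₂ j₃)
    (by rw [he₃, he₂]; push_cast; ring) hin hn₃
  obtain ⟨η, T, hη, hT, heq⟩ := exists_entryState hε₃ hn₃ hout₃ hs₃
  refine ⟨η, T, P₀ ∪ P₁ ∪ (P₂ ∪ P₃), hη, fun Ω R h => ?_⟩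
  obtain ⟨htop, htopR⟩ := h.top (axisPoint ε₁ s₁ (3 / 2)) (by rwa [abs_axisPoint hε₁]) rfl
  obtain ⟨hwing, hwingR⟩ := h.wing (axisPoint ε₂ s₂ 1) (by rwa [abs_axisPoint hε₂])
    (by rwa [abs_axisPoint hε₂]) rfl
  have h₃' := h₃ Ω R h
  have hbot := reflects_horizontal hwing c p ε₂ (-1)
  rw [neg_neg] at hbot
  rw [contractState_state heq hT]
  exact (hrise Ω R h).bounce htop.mem_frontier htopR (reflects_horizontal htop c p ε₁ 1)
    ((h₂ Ω R h).bounce hwing.mem_frontier hwingR hbot h₃')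


/-! ### The escape paths and their limit -/

/-- A choice of the passage through `Ω(𝒯₀)` for each entry state: the child `side` through which
the ball leaves, its entry state `next` there, and the path. -/
structure Passage (c p : ℝ) where
  side : EntryState → ℝ
  next : EntryState → EntryState
  path : EntryState → Set ℂ
  side_eq : ∀ S, side S = 1 ∨ side S = -1
  trajectory : ∀ S Ω R, IsLocallyBaseTable Ω R →
    Trajectory Ω R (S.state c p) (contractState (side S) ((next S).state c p)) (path S)

theorem nonempty_passage {c : ℝ} (hc : 0 < c) {p : ℕ} (hp : Odd p) : Nonempty (Passage c p) := by
  choose η T P hη hP using exists_passage hc hp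
  exact ⟨⟨η, T, P, hη, hP⟩⟩

namespace Passage

variable {c p : ℝ} (D : Passage c p)

/-- The path through the layers `0, …, n` of the table. -/
noncomputable def pathUpTo : ℕ → EntryState → Set ℂ
  | 0, S => D.path S
  | n + 1, S => D.path S ∪ contraction (D.side S) '' pathUpTo n (D.next S)

/-- The state at the end of this path. -/
noncomputable def exitState : ℕ → EntryState → ℂ × ℂ
  | 0, S => contractState (D.side S) ((D.next S).state c p)
  | n + 1, S => contractState (D.side S) (exitState n (D.next S))

/-- The end point of this path. -/
noncomputable def exitPoint (n : ℕ) (S : EntryState) : ℂ := (D.exitState n S).1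

/-- The base of the child is interior in `table (n + 1)`, so the first passage and the contracted
remainder join without a collision. One passage serves all tables, since its path was chosen before
`Ω`. -/
theorem trajectory_pathUpTo (n : ℕ) (S : EntryState) :
    Trajectory (table n) (forbidden n) (S.state c p) (D.exitState n S) (D.pathUpTo n S) := by
  induction n generalizing S with
  | zero => exact D.trajectory S _ _ (isLocallyBaseTable_table 0)
  | succ n ih =>
    exact (D.trajectory S _ _ (isLocallyBaseTable_table (n + 1))).cross
      (contraction_mem_interior (D.side_eq S) (D.next S).abs_point rfl)
      ((ih (D.next S)).contraction (D.side_eq S))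

/-- Both contractions act on heights by `y ↦ y / 2 + 3 / 2`, with fixed point 3, so the side taken
does not matter. -/
theorem exitPoint_im (n : ℕ) (S : EntryState) :
    (D.exitPoint n S).im = 3 - 3 / 2 * (1 / 2) ^ n := by
  induction n generalizing S with
  | zero =>
    simp only [exitPoint, exitState, contractState, contraction_im, EntryState.state,
      EntryState.point, axisPoint_im]
    norm_num
  | succ n ih =>
    have : D.exitPoint (n + 1) S = contraction (D.side S) (D.exitPoint n (D.next S)) := rfl
    rw [this, contraction_im, ih, pow_succ]
    ring

theorem onHorizontalSide_exitPoint (n : ℕ) (S : EntryState) :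
    OnHorizontalSide (table n) (D.exitPoint n S) := by
  induction n generalizing S with
  | zero => exact onHorizontalSide_exit (D.side_eq S) (D.next S).abs_point rfl
  | succ n ih =>
    refine (ih (D.next S)).contraction (D.side_eq S) ?_
    rw [← exitPoint, exitPoint_im]
    have : (1 / 2 : ℝ) ^ n ≤ 1 := pow_le_one₀ (by norm_num) (by norm_num)
    linarith

theorem exitPoint_mem_removedSegments (n : ℕ) (S : EntryState) :
    D.exitPoint n S ∈ removedSegments n := by
  induction n generalizing S with
  | zero =>
    refine mem_Phi.2 ⟨D.side S, D.side_eq S, ?_⟩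
    have h := abs_lt.1 (D.next S).abs_point
    simp only [exitPoint, exitState, contractState, expansion_contraction, EntryState.state]
    exact mem_base.2 ⟨⟨by linarith, by linarith⟩, rfl⟩
  | succ n ih =>
    rw [removedSegments_succ]
    refine mem_Phi.2 ⟨D.side S, D.side_eq S, ?_⟩
    simp only [exitPoint, exitState, contractState, expansion_contraction]
    exact ih (D.next S)

theorem pathUpTo_subset_table (n : ℕ) (S : EntryState) : D.pathUpTo n S ⊆ table n :=
  (D.trajectory_pathUpTo n S).subset (isClosed_table n)

theorem exitPoint_mem_pathUpTo (n : ℕ) (S : EntryState) : D.exitPoint n S ∈ D.pathUpTo n S :=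
  (D.trajectory_pathUpTo n S).right_mem

theorem monotone_pathUpTo (S : EntryState) : Monotone fun n => D.pathUpTo n S := by
  refine monotone_nat_of_le_succ fun n => ?_
  induction n generalizing S with
  | zero => exact Set.subset_union_left
  | succ n ih => exact Set.union_subset_union_right _ (Set.image_mono (ih (D.next S)))

theorem dist_le_of_mem_table {m n : ℕ} {z w : ℂ} (hz : z ∈ table m) (hw : w ∈ table n) :
    dist z w ≤ 6 := by
  obtain ⟨h1, h2, h3, h4, -⟩ := bounds_of_mem_table hz
  obtain ⟨h5, h6, h7, h8, -⟩ := bounds_of_mem_table hw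
  rw [dist_eq_norm]
  -- The tables lie in a `3 × 3` box, whence `6 = 3 + 3`.
  refine (Complex.norm_le_abs_re_add_abs_im _).trans ?_
  rw [Complex.sub_re, Complex.sub_im]
  have hre : |z.re - w.re| ≤ 3 := abs_le.2 ⟨by linarith, by linarith⟩
  have him : |z.im - w.im| ≤ 3 := abs_le.2 ⟨by linarith, by linarith⟩
  linarith

/-- The later part of the path is close to the exit point. -/
theorem mem_pathUpTo_or_dist_le {n m : ℕ} (hnm : n ≤ m) (S : EntryState) {z : ℂ}
    (hz : z ∈ D.pathUpTo m S) :
    z ∈ D.pathUpTo n S ∨ dist z (D.exitPoint n S) ≤ 6 * (1 / 2) ^ n := by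
  induction n generalizing m S z with
  | zero =>
    right
    rw [pow_zero, mul_one]
    exact dist_le_of_mem_table (D.pathUpTo_subset_table m S hz)
      (D.pathUpTo_subset_table 0 S (D.exitPoint_mem_pathUpTo 0 S))
  | succ n ih =>
    obtain ⟨m, rfl⟩ : ∃ k, m = k + 1 := ⟨m - 1, by omega⟩
    rcases hz with hz | ⟨w, hw, rfl⟩
    · exact Or.inl (Or.inl hz)
    · refine (ih (by omega) (D.next S) hw).imp (fun h => Or.inr ⟨w, h, rfl⟩) fun h => ?_
      have : D.exitPoint (n + 1) S = contraction (D.side S) (D.exitPoint n (D.next S)) := rfl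
      rw [this, dist_contraction, pow_succ]
      linarith

theorem dist_exitPoint_le {n m : ℕ} (hnm : n ≤ m) (S : EntryState) :
    dist (D.exitPoint n S) (D.exitPoint m S) ≤ 6 * (1 / 2) ^ n := by
  induction n generalizing m S with
  | zero =>
    rw [pow_zero, mul_one]
    exact dist_le_of_mem_table (D.pathUpTo_subset_table 0 S (D.exitPoint_mem_pathUpTo 0 S))
      (D.pathUpTo_subset_table m S (D.exitPoint_mem_pathUpTo m S))
  | succ n ih =>
    obtain ⟨m, rfl⟩ : ∃ k, m = k + 1 := ⟨m - 1, by omega⟩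
    have h : ∀ k, D.exitPoint (k + 1) S = contraction (D.side S) (D.exitPoint k (D.next S)) :=
      fun _ => rfl
    rw [h, h, dist_contraction, pow_succ]
    linarith [ih (show n ≤ m by omega) (D.next S)]

theorem tendsto_bound : Tendsto (fun n : ℕ => (6 : ℝ) * (1 / 2) ^ n) atTop (𝓝 0) := by
  simpa using (tendsto_pow_atTop_nhds_zero_of_lt_one (r := (1 / 2 : ℝ)) (by norm_num)
    (by norm_num)).const_mul 6

theorem exists_tendsto_exitPoint (S : EntryState) :
    ∃ e, Tendsto (fun n => D.exitPoint n S) atTop (𝓝 e) := by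
  refine cauchySeq_tendsto_of_complete (cauchySeq_of_le_tendsto_0' _ ?_ tendsto_bound)
  exact fun n m hnm => D.dist_exitPoint_le hnm S

/-- The right-hand side is closed and contains every path. Both the Hausdorff convergence and the
uniqueness of the elusive point rest on it. -/
theorem closure_iUnion_subset (n : ℕ) (S : EntryState) :
    closure (⋃ m, D.pathUpTo m S) ⊆
      D.pathUpTo n S ∪ Metric.closedBall (D.exitPoint n S) (6 * (1 / 2) ^ n) := by
  refine closure_minimal (Set.iUnion_subset fun m z hz => ?_)
    ((D.trajectory_pathUpTo n S).isClosed.union Metric.isClosed_closedBall)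
  exact D.mem_pathUpTo_or_dist_le (le_max_left n m) S
    (D.monotone_pathUpTo S (le_max_right n m) hz)

theorem tendsto_hausdorffEDist (S : EntryState) :
    Tendsto (fun n => Metric.hausdorffEDist (D.pathUpTo n S) (closure (⋃ m, D.pathUpTo m S)))
      atTop (𝓝 0) := by
  have hb := ENNReal.tendsto_ofReal tendsto_bound
  rw [ENNReal.ofReal_zero] at hb
  refine tendsto_of_tendsto_of_tendsto_of_le_of_le tendsto_const_nhds hb (fun _ => zero_le)
    fun n => Metric.hausdorffEDist_le_of_mem_edist ?_ ?_
  · exact fun z hz => ⟨z, subset_closure (Set.mem_iUnion.2 ⟨n, hz⟩), by simp⟩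
  · intro z hz
    rcases D.closure_iUnion_subset n S hz with h | h
    · exact ⟨z, h, by simp⟩
    · refine ⟨_, D.exitPoint_mem_pathUpTo n S, ?_⟩
      rw [edist_dist]
      exact ENNReal.ofReal_le_ofReal h

/-- The limit has height 3, above all tables. An elusive point of the closure is on none of the
paths, so it is within `6 * (1 / 2) ^ n` of every exit point and equals the limit. -/
theorem closure_inter_elusivePoints (S : EntryState) {e : ℂ}
    (he : Tendsto (fun n => D.exitPoint n S) atTop (𝓝 e)) :
    e ∈ elusivePoints ∧ closure (⋃ m, D.pathUpTo m S) ∩ elusivePoints = {e} := by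
  have hmem : e ∈ closure (⋃ m, D.pathUpTo m S) :=
    mem_closure_of_tendsto he (Eventually.of_forall fun n =>
      Set.mem_iUnion.2 ⟨n, D.exitPoint_mem_pathUpTo n S⟩)
  have him : e.im = 3 := by
    have h1 := (Complex.continuous_im.tendsto e).comp he
    have h2 : Tendsto (fun n : ℕ => (3 : ℝ) - 3 / 2 * (1 / 2) ^ n) atTop (𝓝 (3 - 3 / 2 * 0)) :=
      tendsto_const_nhds.sub ((tendsto_pow_atTop_nhds_zero_of_lt_one (by norm_num)
        (by norm_num)).const_mul _)
    rw [mul_zero, sub_zero] at h2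
    exact tendsto_nhds_unique h1 (h2.congr fun n => (D.exitPoint_im n S).symm)
  have hel : e ∈ elusivePoints := by
    refine ⟨closure_mono (Set.iUnion_mono fun n => D.pathUpTo_subset_table n S) hmem, fun h => ?_⟩
    obtain ⟨n, hn⟩ := Set.mem_iUnion.1 h
    linarith [(bounds_of_mem_table hn).2.1]
  refine ⟨hel, Set.eq_singleton_iff_unique_mem.2 ⟨⟨hmem, hel⟩, ?_⟩⟩
  rintro z ⟨hz, -, hz'⟩
  have hdist : ∀ n, dist z (D.exitPoint n S) ≤ 6 * (1 / 2) ^ n := fun n =>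
    (D.closure_iUnion_subset n S hz).resolve_left fun h =>
      hz' (Set.mem_iUnion.2 ⟨n, D.pathUpTo_subset_table n S h⟩)
  have := le_of_tendsto_of_tendsto' (tendsto_const_nhds.dist he) tendsto_bound hdist
  exact dist_le_zero.1 this

end Passage

theorem isInitialCondition_of_entryState {c p : ℝ} (hc : 0 < c) (hp : 0 < p) (S : EntryState)
    {θ : ℝ} (hθ : direction θ = velocity c p S.dir 1) (n : ℕ) :
    IsInitialCondition n S.point θ := by
  refine ⟨(onHorizontalSide_base S.abs_point rfl).mem_frontier, ?_⟩
  have hs := abs_lt.1 S.abs_pos_lt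
  -- A rise that ends within the stem and no later than the first wall hit.
  set H := min (1 / 2) ((1 / 2 - S.pos) / p)
  have hH : 0 < H := lt_min (by norm_num) (div_pos (by linarith) hp)
  have hpH : p * H ≤ 1 / 2 - S.pos := by
    rw [mul_comm, ← le_div_iff₀ hp]; exact min_le_right _ _
  have hH1 : H ≤ 1 / 2 := min_le_left _ _
  obtain ⟨-, t, ht, -, hi⟩ := (isLocallyBaseTable_table n).stem.approach (y := 0) (H := H) hc hp
    S.dir_eq (Or.inl rfl) hs.1.le (by linarith) hH ⟨le_rfl, zero_le_one⟩
    ⟨by linarith, by linarith⟩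
  filter_upwards [Ioo_mem_nhdsGT ht] with u hu
  rw [hθ]
  exact hi u hu

/-- The conclusion for one direction. -/
theorem nontrivialPath_of_entryState {c : ℝ} (hc : 0 < c) {p : ℕ} (hp : Odd p) (S : EntryState)
    {θ : ℝ} (hθ : direction θ = velocity c p S.dir 1) {x : ℕ → ℂ} (hx : ∀ n, x n = S.point) :
    YieldsNontrivialPath x θ ∧
      Tendsto (fun n => Metric.hausdorffEDist (escapePath n (x n) θ) (nontrivialPath x θ))
        atTop (𝓝 0) ∧
      ∃ e ∈ elusivePoints, nontrivialPath x θ ∩ elusivePoints = {e} ∧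
        ∃ y : ℕ → ℂ, (∀ n, IsEscapePoint n (x n) θ (y n)) ∧ Tendsto y atTop (𝓝 e) := by
  obtain ⟨D⟩ := nonempty_passage hc hp
  have key : ∀ n, escapeTime n (x n) θ < ⊤ ∧ IsEscapePoint n (x n) θ (D.exitPoint n S) ∧
      escapePath n (x n) θ = D.pathUpTo n S := by
    intro n
    have htr := D.trajectory_pathUpTo n S
    rw [EntryState.state, ← hx n, ← hθ] at htr
    exact htr.escape Set.subset_union_left (D.exitPoint_mem_removedSegments n S)
      (D.onHorizontalSide_exitPoint n S).mem_frontier (D.onHorizontalSide_exitPoint n S)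
  have hpath : nontrivialPath x θ = closure (⋃ m, D.pathUpTo m S) := by
    simp only [nontrivialPath, fun n => (key n).2.2]
  obtain ⟨e, he⟩ := D.exists_tendsto_exitPoint S
  obtain ⟨h1, h2⟩ := D.closure_inter_elusivePoints S he
  refine ⟨⟨⟨fun n => ?_, fun m n _ => ⟨⟨0, ?_⟩, ?_⟩⟩, fun n => (key n).1⟩, ?_, e, h1, ?_, _,
    fun n => (key n).2.1, he⟩
  · rw [hx]
    exact isInitialCondition_of_entryState hc (by exact_mod_cast hp.pos) S hθ n
  · simp [hx]
  · have hmem : S.point ∈ table n := (isClosed_table n).frontier_subset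
      (onHorizontalSide_base S.abs_point rfl).mem_frontier
    rw [hx, hx, segment_same, Set.inter_eq_left]
    exact Set.singleton_subset_iff.2 hmem
  · simp only [fun n => (key n).2.2, hpath]
    exact D.tendsto_hausdorffEDist S
  · rw [hpath]
    exact h2

/-! ### The corner of the base -/

theorem eventually_mem_baseTable_corner : ∀ᶠ z : ℂ in 𝓝 ⟨1, 1⟩,
    z ∈ baseTable ↔ (z.re ≤ 1 ∨ 1 ≤ z.im) := by
  filter_upwards [eventually_re_mem (z := ⟨1, 1⟩) (a := 0) (b := 3 / 2) (by norm_num)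
    (by norm_num), eventually_im_mem (z := ⟨1, 1⟩) (a := 0) (b := 3 / 2) (by norm_num)
    (by norm_num)] with z hz hz'
  rw [mem_baseTable]
  constructor
  · rintro (h | h)
    · exact Or.inl h.1.2
    · exact Or.inr h.2.1
  · intro h
    rcases le_total 1 z.im with h1 | h1
    · exact Or.inr ⟨⟨by linarith, by linarith⟩, h1, by linarith⟩
    · rcases h with h | h
      · exact Or.inl ⟨⟨by linarith, h⟩, by linarith, h1⟩
      · exact Or.inr ⟨⟨by linarith, by linarith⟩, h, by linarith⟩

/-- Near `(1, 1)` the table is three quadrants and contains both axis-parallel lines through the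
vertex. A half-plane lacks one side of the line normal to its boundary, and a quadrant one side of
the horizontal line. -/
theorem not_reflects_corner (v w : ℂ) : ¬ Reflects (table 0) ⟨1, 1⟩ v w := by
  rw [table_zero]
  have hc := eventually_mem_baseTable_corner
  rintro (⟨h | h, -⟩ | ⟨h | h, -⟩ | ⟨⟨a, b, ha, hb, h⟩, -⟩)
  · obtain ⟨t, ht, ⟨h1, h2⟩, h3, h4⟩ := eventually_line (h.and hc) Complex.I
    simp at h1 h2 h3 h4
    linarith [h3.1 h4]
  · obtain ⟨t, ht, ⟨h1, h2⟩, h3, h4⟩ := eventually_line (h.and hc) Complex.I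
    simp at h1 h2 h3 h4
    linarith [h1.1 h2]
  · obtain ⟨t, ht, ⟨h1, h2⟩, h3, h4⟩ := eventually_line (h.and hc) 1
    simp at h1 h2 h3 h4
    linarith [h3.1 h4]
  · obtain ⟨t, ht, ⟨h1, h2⟩, h3, h4⟩ := eventually_line (h.and hc) 1
    simp at h1 h2 h3 h4
    linarith [h1.1 h2]
  · obtain ⟨t, ht, ⟨h1, h2⟩, h3, h4⟩ := eventually_line (h.and hc) 1
    simp at h1 h2 h3 h4
    have e1 := h1.1 h2
    have e2 := h3.1 h4
    have : a * t = 0 := by linarith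
    simp [ha, ht.ne'] at this

theorem corner_mem_frontier : (⟨1, 1⟩ : ℂ) ∈ frontier (table 0) := by
  rw [table_zero, isClosed_baseTable.frontier_eq]
  refine ⟨eventually_mem_baseTable_corner.self_of_nhds.2 (Or.inl le_rfl), fun h => ?_⟩
  rw [mem_interior_iff_mem_nhds] at h
  obtain ⟨t, ht, ⟨h1, h2⟩, -⟩ := eventually_line
    (eventually_mem_baseTable_corner.and (show ∀ᶠ z in 𝓝 _, z ∈ baseTable from h)) ⟨1, -1⟩
  rcases h1.1 h2 with h3 | h3 <;> simp at h3 <;> linarith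

/-- The orbit that starts in the corner of the base arrives at the vertex `(1, 1)`. -/
theorem not_isPeriodicOrbit_corner {c : ℝ} (hc : 0 < c) {p : ℕ} (hp : Odd p) {θ : ℝ}
    (hθ : direction θ = velocity c p 1 1) : ¬ IsPeriodicOrbit 0 0 θ := by
  obtain ⟨k, P, hk, hP⟩ := exists_transit (c := c) (p := p) (w := 1) (h₀ := 0) (h₁ := 1) (σ := 1)
    (ε := 1) (s := -(1 / 2)) (y := 0) (H := 1) hc (by exact_mod_cast hp.pos) one_pos (Or.inl rfl)
    (Or.inl rfl) le_rfl (by norm_num) one_pos (by norm_num) (by norm_num)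
  have htr := hP _ _ (isLocallyBaseTable_table 0).stem
  have hstart : axisPoint 1 (-(1 / 2)) 0 = 0 := by apply Complex.ext <;> simp
  have hend : axisPoint ((-1) ^ k * 1) (-(1 / 2) + p * 1 - k * 1) (0 + 1 * 1) = ⟨1, 1⟩ := by
    -- Arrival in a corner allows two counts, according to whether the last wall hit is included;
    -- both describe `(1, 1)`.
    have hkp : k = p ∨ k + 1 = p := by
      rw [abs_le] at hk
      have h1 : (p : ℝ) ≤ k + 1 := by linarith
      have h2 : (k : ℝ) ≤ p := by linarith
      have h3 : p ≤ k + 1 := by exact_mod_cast h1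
      have h4 : k ≤ p := by exact_mod_cast h2
      omega
    apply Complex.ext
    · rw [axisPoint_re]
      rcases hkp with rfl | rfl
      · rw [hp.neg_one_pow]; ring
      · rw [Even.neg_one_pow (by rcases Nat.even_or_odd k with h | h
                                 · exact h
                                 · exact absurd h.add_one (Nat.not_even_iff_odd.2 hp))]
        push_cast
        ring
    · simp
  rw [hstart, hend, ← hθ] at htr
  exact htr.not_isPeriodicOrbit (Or.inr (by simp)) corner_mem_frontier (not_reflects_corner _)

/-! ### The initial conditions -/

theorem direction_eq (θ : ℝ) : direction θ = ⟨Real.cos θ, Real.sin θ⟩ := by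
  rw [direction, Complex.exp_mul_I]
  apply Complex.ext <;> simp [← Complex.ofReal_cos, ← Complex.ofReal_sin]

/-- The interior of the table lies in the open upper half-plane, so an inward direction at the base
points upwards. -/
theorem sin_pos_of_isInitialCondition {n : ℕ} {z : ℂ} {θ : ℝ} (hz : z ∈ base)
    (h : IsInitialCondition n z θ) : 0 < Real.sin θ := by
  obtain ⟨t, ht, ht0⟩ := (h.2.and self_mem_nhdsWithin).exists
  have hsub : interior (table n) ⊆ {w : ℂ | 0 < w.im} := by
    have h0 : table n ⊆ {w : ℂ | 0 ≤ w.im} := fun w hw => (bounds_of_mem_table hw).1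
    have := interior_mono h0
    rwa [Complex.interior_setOfPred_le_im] at this
  have h1 := hsub ht
  rw [Set.mem_ofPred_eq, direction_eq] at h1
  simp [(mem_base.1 hz).2] at h1
  exact (pos_iff_pos_of_mul_pos h1).1 ht0

theorem nonDyadic_sub_half {a : ℝ} (h0 : 0 < a)
    (h : ∀ m l : ℕ, 0 < m → 0 < l → a ≠ (m : ℝ) / 2 ^ l) : NonDyadic (a - 1 / 2) := by
  intro m l hml
  -- `NonDyadic` allows any integer numerator and exponent 0. Here the exponent is positive, and `0
  -- < a` makes the numerator positive.
  have ha : a = ((2 * m + 2 ^ l : ℤ) : ℝ) / 2 ^ (l + 1) := by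
    rw [sub_eq_iff_eq_add.1 hml, pow_succ]
    push_cast
    field_simp
  have hpos : 0 < 2 * m + (2 : ℤ) ^ l := by
    rw [ha, div_pos_iff_of_pos_right (by positivity)] at h0
    exact_mod_cast h0
  refine h (2 * m + 2 ^ l).toNat (l + 1) (by omega) (by omega) ?_
  rw [ha]
  congr 1
  exact_mod_cast (Int.toNat_of_nonneg hpos.le).symm

end TFractal

open TFractal
theorem mainTheorem6 (p : ℕ) (hp : Odd p) (x : ℕ → ℂ) (θ : ℝ)
    (hbase : x 0 ∈ base)
    (hdyadic : ∀ m l : ℕ, 0 < m → 0 < l → (x 0).re ≠ (m : ℝ) / 2 ^ l)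
    (htan : Real.tan θ = 1 / (p : ℝ))
    (hseq : IsCompatiblePeriodicSequence x θ) :
    (∀ n, x n = x 0) ∧
      ∀ α ∈ ({θ, Real.pi - θ} : Set ℝ),
        YieldsNontrivialPath x α ∧
        Tendsto (fun n => Metric.hausdorffEDist (escapePath n (x n) α) (nontrivialPath x α))
          atTop (𝓝 0) ∧
        ∃ e ∈ elusivePoints,
          nontrivialPath x α ∩ elusivePoints = {e} ∧
          ∃ y : ℕ → ℂ, (∀ n, IsEscapePoint n (x n) α (y n)) ∧ Tendsto y atTop (𝓝 e) := by
  obtain ⟨⟨hinit, hcomp⟩, hper⟩ := hseq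
  have hconst : ∀ n, x n = x 0 := by
    intro n
    rcases n.eq_zero_or_pos with rfl | hn
    · rfl
    -- `x 0` is itself a point of the segment in `table n`, and compatibility allows only one.
    · have hmem : x 0 ∈ segment ℝ (x 0) (x n) ∩ table n :=
        ⟨left_mem_segment ℝ _ _, base_subset_table n hbase⟩
      rw [(hcomp 0 n hn).2] at hmem
      exact hmem.symm
  refine ⟨hconst, ?_⟩
  have hsin := sin_pos_of_isInitialCondition hbase (hinit 0)
  have hp0 : (0 : ℝ) < p := by exact_mod_cast hp.pos
  have hcos : Real.cos θ = Real.sin θ * p := by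
    rw [Real.tan_eq_sin_div_cos] at htan
    have hne : Real.cos θ ≠ 0 := by
      intro h
      rw [h, div_zero] at htan
      exact (one_div_pos.2 hp0).ne htan
    rw [div_eq_div_iff hne hp0.ne'] at htan
    linarith
  have hθ : direction θ = velocity (Real.sin θ) p 1 1 := by
    rw [direction_eq, hcos, velocity, one_mul, mul_one]
  have hθ' : direction (Real.pi - θ) = velocity (Real.sin θ) p (-1) 1 := by
    rw [direction_eq, Real.cos_pi_sub, Real.sin_pi_sub, hcos, velocity, mul_one]
    ring_nf
  obtain ⟨⟨h0, h1⟩, him⟩ := mem_base.1 hbase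
  have h0' : 0 < (x 0).re := by
    -- The dyadic condition has `0 < m` and does not exclude abscissa 0; periodicity in `table 0`
    -- does.
    refine lt_of_le_of_ne h0 fun h => ?_
    have hx0 : x 0 = 0 := Complex.ext h.symm him
    exact not_isPeriodicOrbit_corner hsin hp hθ (hx0 ▸ hper 0)
  have h1' : (x 0).re < 1 :=
    lt_of_le_of_ne h1 fun h => hdyadic 2 1 two_pos one_pos (by rw [h]; norm_num)
  have hnd := nonDyadic_sub_half h0' hdyadic
  have hnd' : NonDyadic (-((x 0).re - 1 / 2)) := fun m l h => hnd (-m) l (by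
    push_cast; rw [neg_div, ← h, neg_neg])
  have habs : |(x 0).re - 1 / 2| < 1 / 2 := abs_lt.2 ⟨by linarith, by linarith⟩
  rintro α (rfl | rfl)
  · refine nontrivialPath_of_entryState hsin hp ⟨1, (x 0).re - 1 / 2, Or.inl rfl, habs, hnd⟩ hθ
      fun n => ?_
    rw [hconst n]
    apply Complex.ext <;> simp [EntryState.point, him]
  -- The same point seen by a ball moving left: the relative position changes sign.
  · refine nontrivialPath_of_entryState hsin hp
      ⟨-1, -((x 0).re - 1 / 2), Or.inr rfl, by rwa [abs_neg], hnd'⟩ hθ' fun n => ?_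
    rw [hconst n]
    apply Complex.ext <;> simp [EntryState.point, him]
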